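/- Let $0<\beta<1$ and $w_\beta(x)=(1+x^2)^{-\beta/2}$ for $x\in\mathbb R$, and let $L^p(w_\beta\,dx)$ be the space of real-valued measurable functions $f$ on $\mathbb R$ with $\int |f|^p w_\beta\,dx<\infty$. For $0<\alpha<2$ let $\Lambda^\alpha=(-\Delta)^{\alpha/2}$, that is, $$\Lambda^\alpha f(x)=C_\alpha\,\mathrm{P.V.}\!\int_{\mathbb R}\frac{f(x)-f(x-y)}{|y|^{1+\alpha}}\,dy,\qquad C_\alpha=\frac{2^\alpha\,\Gamma(\frac{1+\alpha}{2})}{\sqrt\pi\,|\Gamma(-\frac{\alpha}{2})|},$$ and $\Lambda=\Lambda^1$ (so $C_1=1/\pi$). For a smooth positive function $m$, let $\frac1m[\Lambda^\alpha,m]f=\frac1m\big(\Lambda^\alpha(mf)-m\,\Lambda^\alpha f\big)$. We say that $\frac1m[\Lambda^\alpha,m]$ is bounded on $L^p(w_\beta\,dx)$ if there is a bounded linear operator $T:L^p(w_\beta\,dx)\to L^p(w_\beta\,dx)$ such that: - for $f\in C_c^\infty(\mathbb R)$ the principal values defining $\Lambda^\alpha f(x)$ and $\Lambda^\alpha(mf)(x)$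 exist at every $x$, and $Tf=\frac1m[\Lambda^\alpha,m]f$ almost everywhere; - for every $f\in L^p(w_\beta\,dx)$, $Tf=\frac1m[\Lambda^\alpha,m]f$ in the sense of distributions, that is, for every $\varphi\in C_c^\infty(\mathbb R)$, $$\int (Tf)\,\varphi\,dx=\int m f\,\Lambda^\alpha\!\Big(\frac{\varphi}{m}\Big)dx-\int f\,\Lambda^\alpha\varphi\,dx,$$ where all three integrals converge absolutely. Then: 1. If $2\le p<\infty$ and $\frac32-\beta\big(1-\frac1p\big)>1$, the operator $\frac1{w_\beta}[\Lambda^{1/2},w_\beta]$ is bounded on $L^p(w_\beta\,dx)$. 2. If $2\le p<\infty$, the operator $\frac1{\sqrt{w_\beta}}[\Lambda,\sqrt{w_\beta}]$ is bounded on $L^p(w_\beta\,dx)$. -/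

import Mathlib

open MeasureTheory Filter Topology
open scoped ENNReal ContDiff

/-- The weight `w_β(x) = (1 + x²)^(-β/2)`. -/
noncomputable def weight (β : ℝ) (x : ℝ) : ℝ := (1 + x ^ 2) ^ (-β / 2)

theorem weight_pos (β x : ℝ) : 0 < weight β x :=
  Real.rpow_pos_of_pos (by positivity) _

/-- The measure `w_β dx` on the real line; `Lp ℝ p (weightMeasure β)` is `L^p(w_β dx)`. -/
noncomputable def weightMeasure (β : ℝ) : Measure ℝ :=
  volume.withDensity fun x => ENNReal.ofReal (weight β x)

/-- The normalizing constant of `(-Δ)^(α/2)` on the real line,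
`2^α Γ((1+α)/2) / (√π |Γ(-α/2)|)`, for which the Fourier symbol of the operator is `|ξ|^α`. -/
noncomputable def fracConst (α : ℝ) : ℝ :=
  2 ^ α * Real.Gamma ((1 + α) / 2) / (√Real.pi * |Real.Gamma (-α / 2)|)

/-- The normalization gives the familiar factor `1/π` for `Λ = (-Δ)^(1/2)`. -/
theorem fracConst_one : fracConst 1 = 1 / Real.pi := by
  have h := Real.Gamma_add_one (s := -1 / 2) (by norm_num)
  have h0 : (-1 / 2 + 1 : ℝ) = 1 / 2 := by norm_num
  rw [h0, Real.Gamma_one_half_eq] at h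
  have h2 : Real.Gamma (-1 / 2) = -(2 * √Real.pi) := by linarith
  have hs : √Real.pi * √Real.pi = Real.pi := Real.mul_self_sqrt Real.pi_pos.le
  have hpos : 0 < √Real.pi := Real.sqrt_pos.2 Real.pi_pos
  unfold fracConst
  rw [h2, abs_neg, abs_of_pos (by positivity)]
  norm_num
  field_simp
  nlinarith

/-- The integrand of the singular integral of `Λ^α f` at `x`. -/
noncomputable def fracIntegrand (α : ℝ) (f : ℝ → ℝ) (x y : ℝ) : ℝ :=
  (f x - f (x - y)) / |y| ^ (1 + α)

/-- The truncated singular integral `C_α ∫_{|y| > ε} (f(x) - f(x-y)) / |y|^(1+α) dy`. -/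
noncomputable def fracTrunc (α : ℝ) (f : ℝ → ℝ) (x ε : ℝ) : ℝ :=
  fracConst α * ∫ y in {y : ℝ | ε < |y|}, fracIntegrand α f x y

/-- `Λ^α f(x) = C_α P.V. ∫ (f(x) - f(x-y)) / |y|^(1+α) dy`. -/
noncomputable def fracLap (α : ℝ) (f : ℝ → ℝ) (x : ℝ) : ℝ :=
  limUnder (𝓝[>] (0 : ℝ)) (fracTrunc α f x)

/-- The principal value that defines `Λ^α f(x)` exists: the truncated integrals converge
absolutely, and they have a limit, which is `fracLap α f x`. -/
def FracLapExists (α : ℝ) (f : ℝ → ℝ) (x : ℝ) : Prop :=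
  (∀ ε > 0, IntegrableOn (fracIntegrand α f x) {y : ℝ | ε < |y|}) ∧
    Tendsto (fracTrunc α f x) (𝓝[>] (0 : ℝ)) (𝓝 (fracLap α f x))

/-- Test functions: smooth and compactly supported. -/
def IsTestFunction (φ : ℝ → ℝ) : Prop :=
  ContDiff ℝ ∞ φ ∧ HasCompactSupport φ

/-- `(1/m) [Λ^α, m] f = (1/m) (Λ^α (m f) - m Λ^α f)`, computed pointwise. -/
noncomputable def commutatorAt (α : ℝ) (m f : ℝ → ℝ) (x : ℝ) : ℝ :=
  1 / m x * (fracLap α (fun y => m y * f y) x - m x * fracLap α f x)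

/-- `g = (1/m) [Λ^α, m] f` in the sense of distributions, where `m` is smooth and positive and
`⟨Λ^α h, ψ⟩ = ∫ h Λ^α ψ`. Testing against `φ`, the term `(1/m) Λ^α (m f)` gives
`∫ m f Λ^α (φ/m)` and the term `Λ^α f` gives `∫ f Λ^α φ`; all pairings converge absolutely. -/
def IsDistribCommutator (α : ℝ) (m f g : ℝ → ℝ) : Prop :=
  ∀ φ : ℝ → ℝ, IsTestFunction φ →
    Integrable (fun x => g x * φ x) ∧
    Integrable (fun x => m x * f x * fracLap α (fun y => φ y / m y) x) ∧
    Integrable (fun x => f x * fracLap α φ x) ∧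
    ∫ x, g x * φ x =
      (∫ x, m x * f x * fracLap α (fun y => φ y / m y) x) - ∫ x, f x * fracLap α φ x

/-- `(1/m) [Λ^α, m]` is bounded on `L^p(μ)`: there is a bounded linear operator `T` of `L^p(μ)`
which on test functions is the pointwise commutator (every principal value in it exists), and
such that `T f` is the commutator in the sense of distributions for every `f` in `L^p(μ)`. -/
def CommutatorBounded (α : ℝ) (m : ℝ → ℝ) (p : ℝ≥0∞) [Fact (1 ≤ p)] (μ : Measure ℝ) : Prop :=
  ∃ T : Lp ℝ p μ →L[ℝ] Lp ℝ p μ,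
    (∀ f : ℝ → ℝ, IsTestFunction f →
      (∀ x, FracLapExists α f x ∧ FracLapExists α (fun y => m y * f y) x) ∧
      ∃ hf : MemLp f p μ, T (hf.toLp f) =ᵐ[μ] commutatorAt α m f) ∧
    ∀ f : Lp ℝ p μ, IsDistribCommutator α m f (T f)

/-! Conjugation by `w_β^(1/p) = weight (β/p)` moves the problem to unweighted `L^p(dx)`. In the
commutator with `m = weight γ` the terms containing `f(x)` cancel. With `σ = β/p` and `g = weight σ
* f`, what remains is an integral operator acting on `g`, whose kernel, up to the factor `C_α`, is
`(r^a - r^c) / |y|^(1+α)`, where `r = (1+(x-y)²)/(1+x²)`, `a = σ/2` and `c = (σ-γ)/2`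
(`weight_mul_commutatorAt`).

Since `r` and `1/r` are at most `2(1+y²)`, the kernel is `O(|y|^(2μ-1-α))` at infinity with `μ = max
|a| |c|`. Since `r - 1 = O(y)`, it is `O(|y|^(-α))` near `0`. For `α = 1/2` the hypothesis on `β`
and `p` says that the tail is integrable, and Young's inequality suffices.

For `α = 1` the singularity is only just non-integrable. A second-order expansion of `r^a - r^c`
isolates it as a bounded function of `x` times an odd kernel behaving like `1/y`, with an integrable
remainder (`exists_commutatorKernel_sub_hilbertKernel_le`). It remains to bound a localized Hilbert
transform on `L^p` for `p ≥ 2` (`lintegral_localHilbert`). For even integers `n` this follows by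
integrating the `n`-th power of the Cauchy transform along horizontal lines. `marcinkiewicz`
interpolates between these exponents and Fatou's lemma lets the height tend to `0`.

The bounds on test functions extend by density. The distributional identity passes to the limit
because `Λ^α φ` decays like `|x|^(-1-α)`, fast enough to pair continuously with `L^p(w_β dx)`
(`exists_pairing`). -/

/-! ### Power kernels and elementary bounds for test functions. -/

/-- An even function that is a power of `|y|` near the origin and another one away from it. -/
noncomputable def powKernel (s t y : ℝ) : ℝ := if |y| ≤ 1 then |y| ^ s else |y| ^ t

theorem powKernel_nonneg (s t y : ℝ) : 0 ≤ powKernel s t y := by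
  unfold powKernel; split_ifs <;> positivity

theorem powKernel_neg (s t y : ℝ) : powKernel s t (-y) = powKernel s t y := by
  simp [powKernel]

theorem measurable_powKernel (s t : ℝ) : Measurable (powKernel s t) := by
  unfold powKernel
  refine Measurable.ite (measurableSet_le (by fun_prop) (by fun_prop)) (by fun_prop) (by fun_prop)

theorem integrable_of_even_of_integrableOn_Ioi {f : ℝ → ℝ} (he : ∀ y, f (-y) = f y)
    (h : IntegrableOn f (Set.Ioi 0)) : Integrable f := by
  have h1 : Integrable ((Set.Ioi 0).indicator f) := (integrable_indicator_iff measurableSet_Ioi).2 h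
  refine (h1.add h1.comp_neg).congr ?_
  filter_upwards [compl_mem_ae_iff.2 (measure_singleton (0 : ℝ))] with y hy
  have hy : y ≠ 0 := hy
  rcases lt_or_gt_of_ne hy with h | h
  · simp [Set.indicator, h, h.not_gt, he]
  · simp [Set.indicator, h, h.not_gt]

theorem integrable_powKernel {s t : ℝ} (hs : -1 < s) (ht : t < -1) :
    Integrable (powKernel s t) := by
  refine integrable_of_even_of_integrableOn_Ioi (powKernel_neg s t) ?_
  rw [← Set.Ioc_union_Ioi_eq_Ioi zero_le_one]
  refine IntegrableOn.union ?_ ?_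
  · have : IntegrableOn (fun y : ℝ => y ^ s) (Set.Ioc 0 1) :=
      (intervalIntegrable_iff_integrableOn_Ioc_of_le zero_le_one).1
        (intervalIntegral.intervalIntegrable_rpow' hs)
    refine this.congr_fun (fun y hy => ?_) measurableSet_Ioc
    simp [powKernel, abs_of_pos hy.1, hy.2]
  · refine (integrableOn_Ioi_rpow_of_lt ht zero_lt_one).congr_fun (fun y hy => ?_) measurableSet_Ioi
    have hy : 1 < y := hy
    simp [powKernel, abs_of_pos (zero_lt_one.trans hy), hy.not_ge]

theorem IsTestFunction.deriv {f : ℝ → ℝ} (hf : IsTestFunction f) : IsTestFunction (deriv f) :=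
  ⟨(contDiff_infty_iff_deriv.1 hf.1).2, hf.2.deriv⟩

theorem IsTestFunction.continuous {f : ℝ → ℝ} (hf : IsTestFunction f) : Continuous f :=
  hf.1.continuous

theorem IsTestFunction.exists_abs_le {f : ℝ → ℝ} (hf : IsTestFunction f) :
    ∃ M, 0 ≤ M ∧ ∀ x, |f x| ≤ M := by
  obtain ⟨M, hM⟩ := hf.2.exists_bound_of_continuous hf.continuous
  exact ⟨M, (norm_nonneg _).trans (hM 0), hM⟩

theorem IsTestFunction.exists_support {f : ℝ → ℝ} (hf : IsTestFunction f) :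
    ∃ R, 0 < R ∧ ∀ x, R < |x| → f x = 0 := by
  obtain ⟨R, hR, h⟩ := hf.2.exists_pos_le_norm
  exact ⟨R, hR, fun x hx => h x (by rw [Real.norm_eq_abs]; exact hx.le)⟩

theorem IsTestFunction.exists_lipschitz {f : ℝ → ℝ} (hf : IsTestFunction f) :
    ∃ L, 0 ≤ L ∧ ∀ x y, |f x - f y| ≤ L * |x - y| := by
  obtain ⟨L, hL, h⟩ := hf.deriv.exists_abs_le
  refine ⟨L, hL, fun x y => ?_⟩
  exact Convex.norm_image_sub_le_of_norm_deriv_le (s := Set.univ)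
    (fun z _ => (hf.1.differentiable (by simp)).differentiableAt)
    (fun z _ => h z) convex_univ (Set.mem_univ _) (Set.mem_univ _)

theorem IsTestFunction.exists_second_difference_le {f : ℝ → ℝ} (hf : IsTestFunction f) :
    ∃ K, 0 ≤ K ∧ ∀ x y, |2 * f x - f (x - y) - f (x + y)| ≤ K * min (y ^ 2) 1 := by
  obtain ⟨M, hM, h⟩ := hf.exists_abs_le
  obtain ⟨L, hL, h'⟩ := hf.deriv.exists_lipschitz
  have hd : Differentiable ℝ f := hf.1.differentiable (by simp)
  refine ⟨max L (4 * M), le_max_of_le_left hL, fun x y => ?_⟩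
  rw [mul_min_of_nonneg _ _ (le_max_of_le_left hL)]
  refine le_min ?_ ?_
  -- The second difference is the increment over `[x - y, x]` of `t ↦ f (t + y) - f t`, whose
  -- derivative is at most `L * |y|` because `f'` is Lipschitz.
  · have key := Convex.norm_image_sub_le_of_norm_deriv_le (s := Set.univ)
      (f := fun t => f (t + y) - f t) (C := L * |y|) (x := x) (y := x - y)
      (fun z _ => by fun_prop)
      (fun z _ => by
        rw [deriv_fun_sub (by fun_prop) (by fun_prop), deriv_comp_add_const]
        simpa using h' (z + y) z)
      convex_univ (Set.mem_univ _) (Set.mem_univ _)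
    simp only [sub_add_cancel, Real.norm_eq_abs] at key
    have e1 : |x - y - x| = |y| := by rw [sub_sub_cancel_left, abs_neg]
    rw [e1, mul_assoc, abs_mul_abs_self, ← sq] at key
    have e2 : f x - f (x - y) - (f (x + y) - f x) = 2 * f x - f (x - y) - f (x + y) := by ring
    rw [e2] at key
    exact key.trans (mul_le_mul_of_nonneg_right (le_max_left _ _) (sq_nonneg _))
  · have h1 := abs_le.1 (h x)
    have h2 := abs_le.1 (h (x - y))
    have h3 := abs_le.1 (h (x + y))
    rw [mul_one]
    refine le_trans ?_ (le_max_right _ _)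
    rw [abs_le]; constructor <;> linarith [h1.1, h1.2, h2.1, h2.2, h3.1, h3.2]

/-! ### The fractional Laplacian of test functions: existence, decay, symmetry. -/

/-- The symmetrized integrand of the fractional Laplacian. -/
noncomputable def symmIntegrand (α : ℝ) (f : ℝ → ℝ) (x y : ℝ) : ℝ :=
  (2 * f x - f (x - y) - f (x + y)) / |y| ^ (1 + α)

theorem min_sq_one_div_abs_rpow (α y : ℝ) (hy : y ≠ 0) :
    min (y ^ 2) 1 / |y| ^ (1 + α) = powKernel (1 - α) (-(1 + α)) y := by
  have hy' : 0 < |y| := abs_pos.2 hy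
  unfold powKernel
  split_ifs with h
  · rw [min_eq_left (by rw [← sq_abs]; exact pow_le_one₀ hy'.le h), ← sq_abs,
      show (1 - α : ℝ) = (2 : ℕ) - (1 + α) by push_cast; ring, Real.rpow_sub hy',
      Real.rpow_natCast]
  · rw [min_eq_right (by rw [← sq_abs]; exact one_le_pow₀ (not_le.1 h).le), Real.rpow_neg hy'.le,
      one_div]

/-- The majorant does not depend on `x` and is integrable for `0 < α < 2`. This removes the
principal value and justifies every later use of dominated convergence and Fubini. -/
theorem IsTestFunction.exists_symmIntegrand_le {f : ℝ → ℝ} (hf : IsTestFunction f) (α : ℝ) :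
    ∃ K, 0 ≤ K ∧ ∀ x y, |symmIntegrand α f x y| ≤ K * powKernel (1 - α) (-(1 + α)) y := by
  obtain ⟨K, hK, h⟩ := hf.exists_second_difference_le
  refine ⟨K, hK, fun x y => ?_⟩
  rcases eq_or_ne y 0 with rfl | hy
  · have : symmIntegrand α f x 0 = 0 := by
      simp only [symmIntegrand, sub_zero, add_zero]; rw [show 2 * f x - f x - f x = 0 by ring]; simp
    rw [this, abs_zero]
    exact mul_nonneg hK (powKernel_nonneg _ _ _)
  · rw [← min_sq_one_div_abs_rpow α y hy, symmIntegrand, abs_div, ← mul_div_assoc,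
      abs_of_nonneg (Real.rpow_nonneg (abs_nonneg y) _)]
    gcongr
    exact h x y

theorem measurable_symmIntegrand {f : ℝ → ℝ} (hf : Measurable f) (α : ℝ) :
    Measurable (Function.uncurry (symmIntegrand α f)) := by
  unfold symmIntegrand Function.uncurry
  fun_prop

theorem integrable_symmIntegrand {f : ℝ → ℝ} (hf : IsTestFunction f) {α : ℝ} (h0 : 0 < α)
    (h2 : α < 2) (x : ℝ) : Integrable (symmIntegrand α f x) := by
  obtain ⟨K, hK, h⟩ := hf.exists_symmIntegrand_le α
  refine ((integrable_powKernel (s := 1 - α) (t := -(1 + α)) (by linarith) (by linarith)).const_mul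
    K).mono' ?_ (ae_of_all _ (h x))
  exact ((measurable_symmIntegrand hf.continuous.measurable α).comp
    measurable_prodMk_left).aestronglyMeasurable

theorem rpow_le_powKernel {t ε y : ℝ} (ht : t ≤ 0) (hε : 0 < ε) (hy : ε < |y|) :
    |y| ^ t ≤ max 1 (ε ^ t) * powKernel 0 t y := by
  unfold powKernel
  split_ifs with h
  · rw [Real.rpow_zero, mul_one]
    exact (Real.rpow_le_rpow_of_nonpos hε hy.le ht).trans (le_max_right _ _)
  · exact le_mul_of_one_le_left (by positivity) (le_max_left _ _)

theorem measurableSet_lt_abs (ε : ℝ) : MeasurableSet {y : ℝ | ε < |y|} :=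
  measurableSet_lt (by fun_prop) (by fun_prop)

theorem integrableOn_fracIntegrand {f : ℝ → ℝ} (hf : IsTestFunction f) {α : ℝ} (h0 : 0 < α)
    (x : ℝ) {ε : ℝ} (hε : 0 < ε) : IntegrableOn (fracIntegrand α f x) {y : ℝ | ε < |y|} := by
  obtain ⟨M, hM, h⟩ := hf.exists_abs_le
  have hk := (integrable_powKernel (s := 0) (t := -(1 + α)) (by linarith) (by linarith)).const_mul
    (2 * M * max 1 (ε ^ (-(1 + α))))
  refine hk.integrableOn.mono' ?_ ?_
  · have := hf.continuous.measurable
    unfold fracIntegrand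
    exact (by fun_prop : Measurable _).aestronglyMeasurable
  · filter_upwards [ae_restrict_mem (measurableSet_lt_abs ε)] with y hy
    have hy : ε < |y| := hy
    have h1 := rpow_le_powKernel (t := -(1 + α)) (by linarith) hε hy
    rw [Real.rpow_neg (abs_nonneg y)] at h1
    rw [fracIntegrand, Real.norm_eq_abs, abs_div, abs_of_nonneg (Real.rpow_nonneg (abs_nonneg y) _),
      div_eq_mul_inv, mul_assoc (2 * M)]
    refine mul_le_mul ?_ h1 (by positivity) (by positivity)
    calc |f x - f (x - y)| ≤ |f x| + |f (x - y)| := abs_sub _ _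
      _ ≤ 2 * M := by linarith [h x, h (x - y)]

theorem symmIntegrand_eq_add (α : ℝ) (f : ℝ → ℝ) (x y : ℝ) :
    symmIntegrand α f x y = fracIntegrand α f x y + fracIntegrand α f x (-y) := by
  simp only [symmIntegrand, fracIntegrand, abs_neg, sub_neg_eq_add]
  ring

/-- The truncation set is symmetric, so averaging the integrand over `y` and `-y` leaves the
integral unchanged. -/
theorem fracTrunc_eq_symm {f : ℝ → ℝ} (hf : IsTestFunction f) {α : ℝ} (h0 : 0 < α)
    (x : ℝ) {ε : ℝ} (hε : 0 < ε) :
    fracTrunc α f x ε =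
      fracConst α / 2 * ∫ y, {y : ℝ | ε < |y|}.indicator (symmIntegrand α f x) y := by
  have hi := (integrable_indicator_iff (measurableSet_lt_abs ε)).2
    (integrableOn_fracIntegrand hf h0 x hε)
  have h1 : ∀ y, {y : ℝ | ε < |y|}.indicator (symmIntegrand α f x) y =
      {y : ℝ | ε < |y|}.indicator (fracIntegrand α f x) y +
      {y : ℝ | ε < |y|}.indicator (fracIntegrand α f x) (-y) := by
    intro y
    by_cases hy : ε < |y| <;> simp [Set.indicator, hy, symmIntegrand_eq_add]
  simp_rw [h1]
  rw [integral_add hi hi.comp_neg, integral_neg_eq_self, fracTrunc,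
    integral_indicator (measurableSet_lt_abs ε)]
  ring

theorem tendsto_fracTrunc {f : ℝ → ℝ} (hf : IsTestFunction f) {α : ℝ} (h0 : 0 < α)
    (h2 : α < 2) (x : ℝ) : Tendsto (fracTrunc α f x) (𝓝[>] (0 : ℝ))
      (𝓝 (fracConst α / 2 * ∫ y, symmIntegrand α f x y)) := by
  have h : Tendsto (fun ε : ℝ => fracConst α / 2 *
      ∫ y, {y : ℝ | ε < |y|}.indicator (symmIntegrand α f x) y) (𝓝[>] (0 : ℝ))
      (𝓝 (fracConst α / 2 * ∫ y, symmIntegrand α f x y)) := by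
    refine Tendsto.const_mul _ ?_
    have hi := integrable_symmIntegrand hf h0 h2 x
    refine tendsto_integral_filter_of_dominated_convergence (fun y => ‖symmIntegrand α f x y‖)
      (Eventually.of_forall fun ε => hi.aestronglyMeasurable.indicator (measurableSet_lt_abs ε))
      (Eventually.of_forall fun ε => ae_of_all _ fun y => norm_indicator_le_norm_self _ _)
      hi.norm ?_
    filter_upwards [compl_mem_ae_iff.2 (measure_singleton (0 : ℝ))] with y hy
    have hy : 0 < |y| := abs_pos.2 hy
    refine tendsto_const_nhds.congr' ?_
    filter_upwards [nhdsWithin_le_nhds (Iio_mem_nhds hy)] with ε hε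
    exact (Set.indicator_of_mem (s := {y : ℝ | ε < |y|}) hε _).symm
  refine h.congr' ?_
  filter_upwards [self_mem_nhdsWithin] with ε hε
  exact (fracTrunc_eq_symm hf h0 x hε).symm

theorem fracLap_eq_symm {f : ℝ → ℝ} (hf : IsTestFunction f) {α : ℝ} (h0 : 0 < α)
    (h2 : α < 2) (x : ℝ) : fracLap α f x = fracConst α / 2 * ∫ y, symmIntegrand α f x y :=
  (tendsto_fracTrunc hf h0 h2 x).limUnder_eq

theorem fracLapExists {f : ℝ → ℝ} (hf : IsTestFunction f) {α : ℝ} (h0 : 0 < α)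
    (h2 : α < 2) (x : ℝ) : FracLapExists α f x :=
  ⟨fun _ hε => integrableOn_fracIntegrand hf h0 x hε,
    (fracLap_eq_symm hf h0 h2 x) ▸ tendsto_fracTrunc hf h0 h2 x⟩

theorem measurable_fracLap {f : ℝ → ℝ} (hf : IsTestFunction f) {α : ℝ} (h0 : 0 < α)
    (h2 : α < 2) : Measurable (fracLap α f) := by
  have : fracLap α f = fun x => fracConst α / 2 * ∫ y, symmIntegrand α f x y :=
    funext (fracLap_eq_symm hf h0 h2)
  rw [this]
  exact ((measurable_symmIntegrand hf.continuous.measurable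
    α).stronglyMeasurable.integral_prod_right).measurable.const_mul _

theorem one_le_mul_rpow {s R x : ℝ} (hs : 0 ≤ s) (hx : |x| ≤ R) :
    1 ≤ (1 + R ^ 2) ^ s * (1 + x ^ 2) ^ (-s) := by
  rw [Real.rpow_neg (by positivity), ← div_eq_mul_inv, one_le_div (by positivity)]
  have : x ^ 2 ≤ R ^ 2 := by rw [← sq_abs]; gcongr
  gcongr

theorem IsTestFunction.integrable {f : ℝ → ℝ} (hf : IsTestFunction f) : Integrable f :=
  hf.continuous.integrable_of_hasCompactSupport hf.2

/-- Far from the support only the values `f (x ± y)` contribute, and they vanish unless `|y|` is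
comparable to `|x|`; there the kernel is of size `|x|^(-1-α)`. -/
theorem exists_fracLap_le {f : ℝ → ℝ} (hf : IsTestFunction f) {α : ℝ} (h0 : 0 < α)
    (h2 : α < 2) :
    ∃ K, 0 ≤ K ∧ ∀ x, |fracLap α f x| ≤ K * (1 + x ^ 2) ^ (-((1 + α) / 2)) := by
  obtain ⟨R, hR, hs⟩ := hf.exists_support
  obtain ⟨B, hB, hb⟩ := hf.exists_symmIntegrand_le α
  have hk := integrable_powKernel (s := 1 - α) (t := -(1 + α)) (by linarith) (by linarith)
  set N : ℝ := ∫ y, powKernel (1 - α) (-(1 + α)) y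
  have hN : 0 ≤ N := integral_nonneg (powKernel_nonneg _ _)
  set c := |fracConst α / 2|
  have hc : 0 ≤ c := abs_nonneg _
  set D := max 1 (2 * R)
  have hD1 : 1 ≤ D := le_max_left _ _
  set I : ℝ := ∫ y, |f y|
  have hI : 0 ≤ I := integral_nonneg fun _ => abs_nonneg _
  have hi : Integrable fun y => |f y| := hf.integrable.abs
  -- The first summand serves `|x| ≤ D`, the second `|x| > D`.
  refine ⟨c * (B * N) * (1 + D ^ 2) ^ ((1 + α) / 2) + c * (8 ^ ((1 + α) / 2) * (I + I)),
    by positivity, fun x => ?_⟩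
  rw [fracLap_eq_symm hf h0 h2, abs_mul, add_mul]
  rcases le_or_gt |x| D with hx | hx
  · have h1 : |∫ y, symmIntegrand α f x y| ≤ B * N := by
      rw [← integral_const_mul]
      exact norm_integral_le_of_norm_le (f := symmIntegrand α f x) (hk.const_mul _)
        (ae_of_all _ (hb x))
    have h3 := one_le_mul_rpow (s := (1 + α) / 2) (by linarith) hx
    calc c * |∫ y, symmIntegrand α f x y| ≤ c * (B * N) * 1 := by rw [mul_one]; gcongr
      _ ≤ c * (B * N) * ((1 + D ^ 2) ^ ((1 + α) / 2) * (1 + x ^ 2) ^ (-((1 + α) / 2))) := by gcongr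
      _ ≤ _ := by
        rw [← mul_assoc]
        exact le_add_of_nonneg_right (by positivity)
  · have hxR : 2 * R < |x| := (le_max_right _ _).trans_lt hx
    have hx1 : 1 < |x| := hD1.trans_lt hx
    have key : ∀ y, R < |x| - |y| ∨ (1 + x ^ 2) / 8 ≤ y ^ 2 := by
      intro y
      rcases lt_or_ge R (|x| - |y|) with h | h
      · exact Or.inl h
      · right
        -- Here `y² ≥ x²/4`, and `x² > 1` gives `x²/4 ≥ (1 + x²)/8`.
        have : |x| / 2 ≤ |y| := by linarith
        rw [← sq_abs x, ← sq_abs y]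
        nlinarith
    have h1 : ∀ y, |symmIntegrand α f x y| ≤
        8 ^ ((1 + α) / 2) * (1 + x ^ 2) ^ (-((1 + α) / 2)) * (|f (x - y)| + |f (x + y)|) := by
      intro y
      have hfx : f x = 0 := hs x (by linarith)
      rw [symmIntegrand, abs_div, abs_of_nonneg (Real.rpow_nonneg (abs_nonneg y) _), hfx]
      rcases key y with h | h
      · rw [hs (x - y) (h.trans_le (abs_sub_abs_le_abs_sub x y)),
          hs (x + y) (h.trans_le (by simpa using abs_sub_abs_le_abs_sub x (-y)))]
        simp
      · have h4 : 8 ^ ((1 + α) / 2) * (1 + x ^ 2) ^ (-((1 + α) / 2))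
            = (((1 + x ^ 2) / 8) ^ ((1 + α) / 2))⁻¹ := by
          rw [Real.rpow_neg (by positivity), Real.div_rpow (by positivity) (by norm_num), inv_div]
          rfl
        have h5 : |y| ^ (1 + α) = (y ^ 2) ^ ((1 + α) / 2) := by
          rw [← sq_abs, ← Real.rpow_natCast, ← Real.rpow_mul (abs_nonneg y)]
          congr 1; push_cast; ring
        rw [h4, h5, div_eq_mul_inv, mul_comm]
        gcongr
        rw [mul_zero, zero_sub, ← neg_add', abs_neg]
        exact abs_add_le _ _
    have h6 : Integrable fun y => |f (x - y)| := hi.comp_sub_left x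
    have h7 : Integrable fun y => |f (x + y)| := hi.comp_add_left x
    have h8 : |∫ y, symmIntegrand α f x y| ≤
        8 ^ ((1 + α) / 2) * (1 + x ^ 2) ^ (-((1 + α) / 2)) * (I + I) := by
      have := norm_integral_le_of_norm_le (f := symmIntegrand α f x) ((h6.add h7).const_mul
        (8 ^ ((1 + α) / 2) * (1 + x ^ 2) ^ (-((1 + α) / 2)))) (ae_of_all _ h1)
      simp only [Pi.add_apply] at this
      rwa [integral_const_mul, integral_add h6 h7, integral_sub_left_eq_self (fun y => |f y|),
        integral_add_left_eq_self (fun y => |f y|)] at this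
    calc c * |∫ y, symmIntegrand α f x y|
        ≤ c * (8 ^ ((1 + α) / 2) * (1 + x ^ 2) ^ (-((1 + α) / 2)) * (I + I)) := by gcongr
      _ = c * (8 ^ ((1 + α) / 2) * (I + I)) * (1 + x ^ 2) ^ (-((1 + α) / 2)) := by ring
      _ ≤ _ := le_add_of_nonneg_left (by positivity)

theorem IsTestFunction.mul_comp {f g : ℝ → ℝ} (hf : IsTestFunction f) (hg : IsTestFunction g)
    {u : ℝ → ℝ} (hu : Continuous u) : Integrable fun x => f (u x) * g x :=
  ((hf.continuous.comp hu).mul hg.continuous).integrable_of_hasCompactSupport hg.2.mul_left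

/-- For fixed `y`, translating `x` by `±y` transfers the shift from `f` to `g`, exchanging the two
shifted terms. -/
theorem integral_symmIntegrand_mul {f g : ℝ → ℝ} (hf : IsTestFunction f) (hg : IsTestFunction g)
    (α y : ℝ) :
    ∫ x, symmIntegrand α f x y * g x = ∫ x, f x * symmIntegrand α g x y := by
  have h0 : Integrable fun x => f x * g x := hf.mul_comp hg continuous_id
  have h1 : Integrable fun x => f (x - y) * g x := hf.mul_comp hg (by fun_prop)
  have h2 : Integrable fun x => f (x + y) * g x := hf.mul_comp hg (by fun_prop)
  have h3 : Integrable fun x => f x * g (x - y) := by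
    simpa only [mul_comm] using hg.mul_comp hf (u := fun x => x - y) (by fun_prop)
  have h4 : Integrable fun x => f x * g (x + y) := by
    simpa only [mul_comm] using hg.mul_comp hf (u := fun x => x + y) (by fun_prop)
  have e1 : ∀ x, symmIntegrand α f x y * g x =
      (|y| ^ (1 + α))⁻¹ * (2 * (f x * g x) - f (x - y) * g x - f (x + y) * g x) := by
    intro x; unfold symmIntegrand; ring
  have e2 : ∀ x, f x * symmIntegrand α g x y =
      (|y| ^ (1 + α))⁻¹ * (2 * (f x * g x) - f x * g (x + y) - f x * g (x - y)) := by
    intro x; unfold symmIntegrand; ring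
  simp_rw [e1, e2]
  rw [integral_const_mul, integral_const_mul, integral_sub (f := fun x => 2 * (f x * g x) - f (x - y) * g x) ((h0.const_mul 2).sub h1) h2,
    integral_sub (h0.const_mul 2) h1, 
    integral_sub (f := fun x => 2 * (f x * g x) - f x * g (x + y)) ((h0.const_mul 2).sub h4) h3,
    integral_sub (h0.const_mul 2) h4]
  have e3 : ∫ x, f (x - y) * g x = ∫ x, f x * g (x + y) := by
    rw [← integral_add_right_eq_self _ y]; simp
  have e4 : ∫ x, f (x + y) * g x = ∫ x, f x * g (x - y) := by
    rw [← integral_sub_right_eq_self _ y]; simp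
  rw [e3, e4]

theorem integrable_prod_symmIntegrand_mul {f g : ℝ → ℝ} (hf : IsTestFunction f)
    (hg : IsTestFunction g) {α : ℝ} (h0 : 0 < α) (h2 : α < 2) :
    Integrable (Function.uncurry fun x y => symmIntegrand α f x y * g x)
      ((volume : Measure ℝ).prod volume) := by
  obtain ⟨K, hK, h⟩ := hf.exists_symmIntegrand_le α
  have hk := (integrable_powKernel (s := 1 - α) (t := -(1 + α)) (by linarith)
    (by linarith)).const_mul K
  refine (hg.integrable.abs.mul_prod hk).mono' ?_ (ae_of_all _ fun z => ?_)
  · exact ((measurable_symmIntegrand hf.continuous.measurable α).mul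
      (hg.continuous.measurable.comp measurable_fst)).aestronglyMeasurable
  · simp only [Function.uncurry, norm_mul, Real.norm_eq_abs]
    rw [mul_comm]
    exact mul_le_mul_of_nonneg_left (h _ _) (abs_nonneg _)

/-- `Λ^α` is symmetric on test functions. -/
theorem integral_fracLap_mul {f g : ℝ → ℝ} (hf : IsTestFunction f) (hg : IsTestFunction g)
    {α : ℝ} (h0 : 0 < α) (h2 : α < 2) :
    ∫ x, fracLap α f x * g x = ∫ x, f x * fracLap α g x := by
  have e1 : ∀ x, fracLap α f x * g x = fracConst α / 2 * ∫ y, symmIntegrand α f x y * g x := by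
    intro x; rw [fracLap_eq_symm hf h0 h2, integral_mul_const, mul_assoc]
  have e2 : ∀ x, f x * fracLap α g x = fracConst α / 2 * ∫ y, symmIntegrand α g x y * f x := by
    intro x; rw [fracLap_eq_symm hg h0 h2, integral_mul_const]; ring
  simp_rw [e1, e2]
  rw [integral_const_mul, integral_const_mul,
    integral_integral_swap (integrable_prod_symmIntegrand_mul hf hg h0 h2),
    integral_integral_swap (integrable_prod_symmIntegrand_mul hg hf h0 h2)]
  simp_rw [integral_symmIntegrand_mul hf hg, mul_comm]

/-! ### Jensen, Young and Chebyshev inequalities. -/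

/-- Jensen's inequality for a measure with density `k`. -/
theorem lintegral_mul_rpow_le {k G : ℝ → ℝ≥0∞} (hk : Measurable k) (hG : Measurable G) {p : ℝ}
    (hp : 1 < p) :
    (∫⁻ y, k y * G y) ^ p ≤ (∫⁻ y, k y) ^ (p - 1) * ∫⁻ y, k y * G y ^ p := by
  have hpq : p.HolderConjugate (p.conjExponent) := Real.HolderConjugate.conjExponent hp
  set q := p.conjExponent
  have hp0 : 0 < p := by linarith
  -- Hölder's inequality after writing `k = k^(1/p) * k^(1/q)`.
  have h := ENNReal.lintegral_mul_le_Lp_mul_Lq volume hpq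
    (f := fun y => k y ^ (1 / p) * G y) (g := fun y => k y ^ (1 / q))
    (by fun_prop) (by fun_prop)
  have e1 : ∀ y, ((fun y => k y ^ (1 / p) * G y) * fun y => k y ^ (1 / q)) y = k y * G y := by
    intro y
    simp only [Pi.mul_apply]
    rw [mul_right_comm, ← ENNReal.rpow_add_of_nonneg _ _ (by positivity)
      (one_div_nonneg.2 hpq.symm.pos.le), one_div, one_div, hpq.inv_add_inv_eq_one,
      ENNReal.rpow_one]
  have e2 : ∀ y, (k y ^ (1 / p) * G y) ^ p = k y * G y ^ p := by
    intro y
    rw [ENNReal.mul_rpow_of_nonneg _ _ hp0.le, ← ENNReal.rpow_mul, one_div,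
      inv_mul_cancel₀ hp0.ne', ENNReal.rpow_one]
  have e3 : ∀ y, (k y ^ (1 / q)) ^ q = k y := by
    intro y
    rw [← ENNReal.rpow_mul, one_div, inv_mul_cancel₀ hpq.symm.ne_zero, ENNReal.rpow_one]
  simp_rw [e1, e2, e3] at h
  have h' := ENNReal.rpow_le_rpow h hp0.le
  rw [ENNReal.mul_rpow_of_nonneg _ _ hp0.le, ← ENNReal.rpow_mul, ← ENNReal.rpow_mul, one_div,
    inv_mul_cancel₀ hp0.ne', ENNReal.rpow_one, mul_comm (∫⁻ y, k y * G y ^ p)] at h'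
  have e4 : 1 / q * p = p - 1 := by
    have := hpq.inv_add_inv_eq_one
    rw [one_div]
    field_simp at this ⊢
    nlinarith [hpq.sub_one_mul_conj]
  rwa [e4] at h'

/-- Young's inequality for the convolution with an integrable kernel. -/
theorem lintegral_convolution_rpow_le {k G : ℝ → ℝ≥0∞} (hk : Measurable k) (hG : Measurable G)
    {p : ℝ} (hp : 1 < p) :
    ∫⁻ x, (∫⁻ y, k y * G (x - y)) ^ p ≤ (∫⁻ y, k y) ^ p * ∫⁻ x, G x ^ p := by
  calc ∫⁻ x, (∫⁻ y, k y * G (x - y)) ^ p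
      ≤ ∫⁻ x, (∫⁻ y, k y) ^ (p - 1) * ∫⁻ y, k y * G (x - y) ^ p :=
        lintegral_mono fun x => lintegral_mul_rpow_le hk (by fun_prop) hp
    _ = (∫⁻ y, k y) ^ (p - 1) * ∫⁻ x, ∫⁻ y, k y * G (x - y) ^ p := by
        rw [lintegral_const_mul]
        exact Measurable.lintegral_prod_right
          (by fun_prop : Measurable fun z : ℝ × ℝ => k z.2 * G (z.1 - z.2) ^ p)
    _ = (∫⁻ y, k y) ^ (p - 1) * ∫⁻ y, ∫⁻ x, k y * G (x - y) ^ p := by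
        rw [lintegral_lintegral_swap]
        exact (by fun_prop : Measurable fun z : ℝ × ℝ => k z.2 * G (z.1 - z.2) ^ p).aemeasurable
    _ = (∫⁻ y, k y) ^ (p - 1) * ∫⁻ y, k y * ∫⁻ x, G x ^ p := by
        congr 2 with y
        rw [lintegral_const_mul _ (by fun_prop), lintegral_sub_right_eq_self (fun x => G x ^ p) y]
    _ = (∫⁻ y, k y) ^ p * ∫⁻ x, G x ^ p := by
        rw [lintegral_mul_const _ hk, ← mul_assoc]
        nth_rewrite 2 [← ENNReal.rpow_one (∫⁻ y, k y)]
        rw [← ENNReal.rpow_add_of_nonneg _ _ (by linarith) zero_le_one, sub_add_cancel]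

theorem volume_lt_abs_le {h : ℝ → ℝ} (hh : Measurable h) {s q : ℝ} (hs : 0 < s) (hq : 0 ≤ q) :
    volume {x | s < |h x|} ≤ ENNReal.ofReal (s ^ (-q)) * ∫⁻ x, ENNReal.ofReal (|h x| ^ q) := by
  have h1 := mul_meas_ge_le_lintegral (μ := volume)
    (f := fun x => ENNReal.ofReal (|h x| ^ q)) (by fun_prop) (ENNReal.ofReal (s ^ q))
  have h2 : volume {x | s < |h x|} ≤
      volume {x | ENNReal.ofReal (s ^ q) ≤ ENNReal.ofReal (|h x| ^ q)} := by
    refine measure_mono fun x hx => ENNReal.ofReal_le_ofReal ?_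
    have hx : s < |h x| := hx
    gcongr
  calc volume {x | s < |h x|}
      = ENNReal.ofReal (s ^ (-q)) * (ENNReal.ofReal (s ^ q) * volume {x | s < |h x|}) := by
        rw [← mul_assoc, ← ENNReal.ofReal_mul (by positivity), ← Real.rpow_add hs]
        simp
    _ ≤ _ := by gcongr; exact (mul_le_mul_right h2 _).trans h1

/-! ### Marcinkiewicz interpolation. -/

/-- Bounded measurable functions that vanish outside a bounded interval. -/
def BoundedCompactlySupported (g : ℝ → ℝ) : Prop :=
  Measurable g ∧ (∃ M, ∀ x, |g x| ≤ M) ∧ ∃ R, ∀ x, R < |x| → g x = 0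

theorem BoundedCompactlySupported.indicator {g : ℝ → ℝ} (hg : BoundedCompactlySupported g)
    {s : Set ℝ} (hs : MeasurableSet s) : BoundedCompactlySupported (s.indicator g) := by
  obtain ⟨h1, ⟨M, hM⟩, R, hR⟩ := hg
  exact ⟨h1.indicator hs, ⟨M, fun x => (norm_indicator_le_norm_self g x).trans (hM x)⟩,
    R, fun x hx => by simp [Set.indicator, hR x hx]⟩

theorem lintegral_Ioo_rpow {r a : ℝ} (hr : -1 < r) (ha : 0 ≤ a) :
    ∫⁻ t in Set.Ioo 0 a, ENNReal.ofReal (t ^ r) = ENNReal.ofReal (a ^ (r + 1) / (r + 1)) := by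
  have hi := (intervalIntegrable_iff_integrableOn_Ioo_of_le ha).1
    (intervalIntegral.intervalIntegrable_rpow' (a := 0) (b := a) hr)
  rw [← ofReal_integral_eq_lintegral_ofReal hi, ← integral_Ioc_eq_integral_Ioo,
    ← intervalIntegral.integral_of_le ha, integral_rpow (Or.inl hr),
    Real.zero_rpow (by linarith), sub_zero]
  filter_upwards [ae_restrict_mem measurableSet_Ioo] with t ht
  exact Real.rpow_nonneg ht.1.le _

theorem lintegral_Ici_rpow {r a : ℝ} (hr : r < -1) (ha : 0 < a) :
    ∫⁻ t in Set.Ici a, ENNReal.ofReal (t ^ r) = ENNReal.ofReal (a ^ (r + 1) / -(r + 1)) := by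
  rw [setLIntegral_congr Ioi_ae_eq_Ici.symm,
    ← ofReal_integral_eq_lintegral_ofReal (integrableOn_Ioi_rpow_of_lt hr ha),
    integral_Ioi_rpow_of_lt hr ha, div_neg, neg_div]
  filter_upwards [ae_restrict_mem measurableSet_Ioi] with t ht
  exact Real.rpow_nonneg (ha.trans ht).le _

theorem ofReal_indicator_abs_rpow {q : ℝ} (hq : 0 < q) (s : Set ℝ) (g : ℝ → ℝ) (x : ℝ) :
    ENNReal.ofReal (|s.indicator g x| ^ q) =
      s.indicator (fun x => ENNReal.ofReal (|g x| ^ q)) x := by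
  by_cases h : x ∈ s <;> simp [h, hq.ne']

/-- By Tonelli, each `x` contributes `|g x|^q` times the integral of `t^(p-1-q)` over `(0, |g x|)`,
which converges at `0` because `q < p`. -/
theorem lintegral_truncation_above {g : ℝ → ℝ} (hg : Measurable g) {p q : ℝ} (hq : 0 < q)
    (hp : q < p) :
    ∫⁻ t in Set.Ioi (0 : ℝ), ENNReal.ofReal (t ^ (p - 1 - q)) *
        ∫⁻ x, ENNReal.ofReal (|{x | t < |g x|}.indicator g x| ^ q) =
      ENNReal.ofReal (1 / (p - q)) * ∫⁻ x, ENNReal.ofReal (|g x| ^ p) := by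
  have hm : MeasurableSet {z : ℝ × ℝ | z.1 < |g z.2|} :=
    measurableSet_lt (by fun_prop) (by fun_prop)
  have hF : Measurable fun z : ℝ × ℝ => ENNReal.ofReal (z.1 ^ (p - 1 - q)) *
      {z : ℝ × ℝ | z.1 < |g z.2|}.indicator (fun z => ENNReal.ofReal (|g z.2| ^ q)) z :=
    (by fun_prop : Measurable fun z : ℝ × ℝ => ENNReal.ofReal (z.1 ^ (p - 1 - q))).mul
      ((by fun_prop : Measurable fun z : ℝ × ℝ => ENNReal.ofReal (|g z.2| ^ q)).indicator hm)
  have e1 : ∀ t, ENNReal.ofReal (t ^ (p - 1 - q)) *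
        ∫⁻ x, ENNReal.ofReal (|{x | t < |g x|}.indicator g x| ^ q) =
      ∫⁻ x, ENNReal.ofReal (t ^ (p - 1 - q)) *
        {z : ℝ × ℝ | z.1 < |g z.2|}.indicator (fun z => ENNReal.ofReal (|g z.2| ^ q)) (t, x) := by
    intro t
    rw [← lintegral_const_mul]
    · congr 1 with x
      rw [ofReal_indicator_abs_rpow hq]
      rfl
    · have : MeasurableSet {x | t < |g x|} := measurableSet_lt (by fun_prop) (by fun_prop)
      have := hg.indicator this
      fun_prop
  simp_rw [e1]
  rw [lintegral_lintegral_swap hF.aemeasurable, ← lintegral_const_mul _ (by fun_prop)]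
  congr 1 with x
  have e2 : ∀ t, ENNReal.ofReal (t ^ (p - 1 - q)) *
        {z : ℝ × ℝ | z.1 < |g z.2|}.indicator (fun z => ENNReal.ofReal (|g z.2| ^ q)) (t, x) =
      ENNReal.ofReal (|g x| ^ q) *
        (Set.Iio |g x|).indicator (fun t => ENNReal.ofReal (t ^ (p - 1 - q))) t := by
    intro t
    by_cases h : t < |g x| <;> simp [Set.indicator, h, mul_comm]
  simp_rw [e2]
  rw [lintegral_const_mul _ ((by fun_prop : Measurable _).indicator measurableSet_Iio),
    lintegral_indicator measurableSet_Iio, Measure.restrict_restrict measurableSet_Iio,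
    Set.Iio_inter_Ioi, lintegral_Ioo_rpow (by linarith) (abs_nonneg _),
    ← ENNReal.ofReal_mul (by positivity), ← ENNReal.ofReal_mul (by
      exact one_div_nonneg.2 (by linarith))]
  congr 1
  have e3 : p - 1 - q + 1 = p - q := by ring
  have e4 : |g x| ^ p = |g x| ^ q * |g x| ^ (p - q) := by
    rw [← Real.rpow_add_of_nonneg (abs_nonneg _) hq.le (by linarith)]; congr 1; ring
  rw [e3, e4]; ring

/-- The complementary range is `t ≥ |g x|`; now `p < q` gives convergence at infinity. -/
theorem lintegral_truncation_below {g : ℝ → ℝ} (hg : Measurable g) {p q : ℝ} (hp : 0 < p)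
    (hq : p < q) :
    ∫⁻ t in Set.Ioi (0 : ℝ), ENNReal.ofReal (t ^ (p - 1 - q)) *
        ∫⁻ x, ENNReal.ofReal (|{x | t < |g x|}ᶜ.indicator g x| ^ q) =
      ENNReal.ofReal (1 / (q - p)) * ∫⁻ x, ENNReal.ofReal (|g x| ^ p) := by
  have hq0 : 0 < q := hp.trans hq
  have hm : MeasurableSet {z : ℝ × ℝ | z.1 < |g z.2|}ᶜ :=
    (measurableSet_lt (by fun_prop) (by fun_prop)).compl
  have hF : Measurable fun z : ℝ × ℝ => ENNReal.ofReal (z.1 ^ (p - 1 - q)) *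
      {z : ℝ × ℝ | z.1 < |g z.2|}ᶜ.indicator (fun z => ENNReal.ofReal (|g z.2| ^ q)) z :=
    (by fun_prop : Measurable fun z : ℝ × ℝ => ENNReal.ofReal (z.1 ^ (p - 1 - q))).mul
      ((by fun_prop : Measurable fun z : ℝ × ℝ => ENNReal.ofReal (|g z.2| ^ q)).indicator hm)
  have e1 : ∀ t, ENNReal.ofReal (t ^ (p - 1 - q)) *
        ∫⁻ x, ENNReal.ofReal (|{x | t < |g x|}ᶜ.indicator g x| ^ q) =
      ∫⁻ x, ENNReal.ofReal (t ^ (p - 1 - q)) *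
        {z : ℝ × ℝ | z.1 < |g z.2|}ᶜ.indicator (fun z => ENNReal.ofReal (|g z.2| ^ q)) (t, x) := by
    intro t
    rw [← lintegral_const_mul]
    · congr 1 with x
      rw [ofReal_indicator_abs_rpow hq0]
      rfl
    · have : MeasurableSet {x | t < |g x|}ᶜ :=
        (measurableSet_lt (by fun_prop) (by fun_prop)).compl
      have := hg.indicator this
      fun_prop
  simp_rw [e1]
  rw [lintegral_lintegral_swap hF.aemeasurable, ← lintegral_const_mul _ (by fun_prop)]
  congr 1 with x
  have e2 : ∀ t, ENNReal.ofReal (t ^ (p - 1 - q)) *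
        {z : ℝ × ℝ | z.1 < |g z.2|}ᶜ.indicator (fun z => ENNReal.ofReal (|g z.2| ^ q)) (t, x) =
      ENNReal.ofReal (|g x| ^ q) *
        (Set.Ici |g x|).indicator (fun t => ENNReal.ofReal (t ^ (p - 1 - q))) t := by
    intro t
    by_cases h : t < |g x|
    · simp [Set.indicator, h, h.not_ge]
    · simp [Set.indicator, h, not_lt.1 h, mul_comm]
  simp_rw [e2]
  rw [lintegral_const_mul _ ((by fun_prop : Measurable _).indicator measurableSet_Ici)]
  -- Where `g x = 0` the integral in `t` runs over the whole half line and diverges, but the factor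
  -- `|g x|^q = 0` annihilates it.
  rcases eq_or_ne (g x) 0 with h0 | h0
  · simp [h0, hq0.ne', hp.ne']
  have h0' : 0 < |g x| := abs_pos.2 h0
  rw [lintegral_indicator measurableSet_Ici, Measure.restrict_restrict measurableSet_Ici,
    Set.inter_eq_self_of_subset_left (Set.Ici_subset_Ioi.2 h0'),
    lintegral_Ici_rpow (by linarith) h0',
    ← ENNReal.ofReal_mul (by positivity), ← ENNReal.ofReal_mul (by
      exact one_div_nonneg.2 (by linarith))]
  congr 1
  have e3 : p - 1 - q + 1 = p - q := by ring
  have e4 : |g x| ^ p = |g x| ^ q * |g x| ^ (p - q) := by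
    rw [← Real.rpow_add h0']; congr 1; ring
  rw [e3, e4, neg_sub]; ring

/-- The Marcinkiewicz interpolation theorem between two strong type bounds. -/
theorem marcinkiewicz {q₀ p q₁ : ℝ} (h0 : 0 < q₀) (hp : q₀ < p) (h1 : p < q₁) {A B : ℝ≥0∞}
    (hA : A ≠ ⊤) (hB : B ≠ ⊤) :
    ∃ C : ℝ≥0∞, C ≠ ⊤ ∧ ∀ T : (ℝ → ℝ) → ℝ → ℝ,
      (∀ g, BoundedCompactlySupported g → Measurable (T g)) →
      (∀ g h, BoundedCompactlySupported g → BoundedCompactlySupported h →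
        ∀ x, T (g + h) x = T g x + T h x) →
      (∀ g, BoundedCompactlySupported g →
        ∫⁻ x, ENNReal.ofReal (|T g x| ^ q₀) ≤ A * ∫⁻ x, ENNReal.ofReal (|g x| ^ q₀)) →
      (∀ g, BoundedCompactlySupported g →
        ∫⁻ x, ENNReal.ofReal (|T g x| ^ q₁) ≤ B * ∫⁻ x, ENNReal.ofReal (|g x| ^ q₁)) →
      ∀ g, BoundedCompactlySupported g →
        ∫⁻ x, ENNReal.ofReal (|T g x| ^ p) ≤ C * ∫⁻ x, ENNReal.ofReal (|g x| ^ p) := by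
  have hp0 : 0 < p := h0.trans hp
  -- The constant is fixed before `T`; the application needs a bound uniform over a family of
  -- operators.
  refine ⟨ENNReal.ofReal p * (ENNReal.ofReal (2 ^ q₀) * A * ENNReal.ofReal (1 / (p - q₀)) +
    ENNReal.ofReal (2 ^ q₁) * B * ENNReal.ofReal (1 / (q₁ - p))), by finiteness,
    fun T hm hadd hT0 hT1 g hg => ?_⟩
  have hgm := hg.1
  have hs : ∀ t, MeasurableSet {x | t < |g x|} := fun t =>
    measurableSet_lt (by fun_prop) (by fun_prop)
  rw [lintegral_rpow_eq_lintegral_meas_lt_mul volume (ae_of_all _ fun x => abs_nonneg _)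
    (hm g hg).abs.aemeasurable hp0, mul_assoc]
  gcongr
  have hcheb : ∀ (h : ℝ → ℝ) (q : ℝ) (D : ℝ≥0∞), 0 < q → BoundedCompactlySupported h →
      ∫⁻ x, ENNReal.ofReal (|T h x| ^ q) ≤ D * ∫⁻ x, ENNReal.ofReal (|h x| ^ q) →
      ∀ t, 0 < t → volume {x | t / 2 < |T h x|} * ENNReal.ofReal (t ^ (p - 1)) ≤
        ENNReal.ofReal (2 ^ q) * D * (ENNReal.ofReal (t ^ (p - 1 - q)) *
          ∫⁻ x, ENNReal.ofReal (|h x| ^ q)) := by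
    intro h q D hq hh hD t ht
    have e : (t / 2) ^ (-q) * t ^ (p - 1) = 2 ^ q * t ^ (p - 1 - q) := by
      rw [Real.div_rpow ht.le zero_le_two, Real.rpow_neg zero_le_two, div_inv_eq_mul,
        mul_right_comm, ← Real.rpow_add ht, mul_comm]
      congr 2; ring
    calc volume {x | t / 2 < |T h x|} * ENNReal.ofReal (t ^ (p - 1))
        ≤ (ENNReal.ofReal ((t / 2) ^ (-q)) * (D * ∫⁻ x, ENNReal.ofReal (|h x| ^ q))) *
          ENNReal.ofReal (t ^ (p - 1)) := by
          gcongr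
          exact (volume_lt_abs_le (hm h hh) (half_pos ht) hq.le).trans (by gcongr)
      _ = (ENNReal.ofReal ((t / 2) ^ (-q)) * ENNReal.ofReal (t ^ (p - 1))) *
          (D * ∫⁻ x, ENNReal.ofReal (|h x| ^ q)) := by ring
      _ = _ := by
          rw [← ENNReal.ofReal_mul (by positivity), e, ENNReal.ofReal_mul (by positivity)]
          ring
  have hpt : ∀ t ∈ Set.Ioi (0 : ℝ),
      volume {x | t < |T g x|} * ENNReal.ofReal (t ^ (p - 1)) ≤
      ENNReal.ofReal (2 ^ q₀) * A * (ENNReal.ofReal (t ^ (p - 1 - q₀)) *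
          ∫⁻ x, ENNReal.ofReal (|{x | t < |g x|}.indicator g x| ^ q₀)) +
      ENNReal.ofReal (2 ^ q₁) * B * (ENNReal.ofReal (t ^ (p - 1 - q₁)) *
          ∫⁻ x, ENNReal.ofReal (|{x | t < |g x|}ᶜ.indicator g x| ^ q₁)) := by
    intro t ht
    have hg0 := hg.indicator (hs t)
    have hg1 := hg.indicator (hs t).compl
    -- The function is cut at the same height `t` as the level set: the large part is estimated in
    -- `L^{q₀}`, the small part in `L^{q₁}`.
    have hsub : {x | t < |T g x|} ⊆ {x | t / 2 < |T ({x | t < |g x|}.indicator g) x|} ∪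
        {x | t / 2 < |T ({x | t < |g x|}ᶜ.indicator g) x|} := by
      intro x hx
      by_contra hn
      simp only [Set.mem_union, Set.mem_ofPred_eq, not_or, not_lt] at hn hx
      have e := hadd _ _ hg0 hg1 x
      rw [Set.indicator_self_add_compl] at e
      rw [e] at hx
      linarith [abs_add_le (T ({x | t < |g x|}.indicator g) x)
        (T ({x | t < |g x|}ᶜ.indicator g) x)]
    refine (mul_le_mul_left ((measure_mono hsub).trans (measure_union_le _ _)) _).trans ?_
    rw [add_mul]
    exact add_le_add (hcheb _ _ _ h0 hg0 (hT0 _ hg0) t ht)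
      (hcheb _ _ _ (hp0.trans h1) hg1 (hT1 _ hg1) t ht)
  refine (setLIntegral_mono' measurableSet_Ioi hpt).trans ?_
  have hmeas : Measurable fun t => ENNReal.ofReal (2 ^ q₀) * A *
      (ENNReal.ofReal (t ^ (p - 1 - q₀)) *
        ∫⁻ x, ENNReal.ofReal (|{x | t < |g x|}.indicator g x| ^ q₀)) := by
    have h2 : Measurable fun z : ℝ × ℝ => {z : ℝ × ℝ | z.1 < |g z.2|}.indicator (g ∘ Prod.snd) z :=
      (hgm.comp measurable_snd).indicator (measurableSet_lt (by fun_prop) (by fun_prop))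
    have h3 : Measurable fun z : ℝ × ℝ => ENNReal.ofReal
        (|{z : ℝ × ℝ | z.1 < |g z.2|}.indicator (g ∘ Prod.snd) z| ^ q₀) := by fun_prop
    have h4 := Measurable.lintegral_prod_right' h3 (ν := volume)
    exact ((by fun_prop : Measurable fun t : ℝ => ENNReal.ofReal (t ^ (p - 1 - q₀))).mul
      h4).const_mul _
  rw [lintegral_add_left hmeas, lintegral_const_mul' _ _ (by finiteness),
    lintegral_const_mul' _ _ (by finiteness), lintegral_truncation_above hgm h0 hp,
    lintegral_truncation_below hgm hp0 h1, add_mul, mul_assoc _ (ENNReal.ofReal (1 / (p - q₀))),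
    mul_assoc _ (ENNReal.ofReal (1 / (q₁ - p)))]

/-! ### Conjugate Poisson integrals on `L^p` by contour integration. -/

/-- A holomorphic function on the upper half plane that is `O(|z|⁻²)` above height `ε` has
vanishing integral along the horizontal line at height `ε`. -/
theorem integral_horizontal_eq_zero {G : ℂ → ℂ} (hd : DifferentiableOn ℂ G {z | 0 < z.im})
    {ε K : ℝ} (hε : 0 < ε) (hb : ∀ z : ℂ, ε ≤ z.im → ‖G z‖ ≤ K / ‖z‖ ^ 2) :
    Integrable (fun x : ℝ => G (x + ε * Complex.I)) ∧
    ∫ x : ℝ, G (x + ε * Complex.I) = 0 := by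
  have him : ∀ x y : ℝ, ((x : ℂ) + y * Complex.I).im = y := by intro x y; simp
  have hre : ∀ x y : ℝ, ((x : ℂ) + y * Complex.I).re = x := by intro x y; simp
  have hnorm : ∀ x y : ℝ, ‖(x : ℂ) + y * Complex.I‖ ^ 2 = x ^ 2 + y ^ 2 := by
    intro x y
    rw [← Complex.normSq_eq_norm_sq, Complex.normSq_apply, hre, him]; ring
  have hK : 0 ≤ K := by
    have h1 := (norm_nonneg _).trans (hb ((0 : ℝ) + ε * Complex.I) (by rw [him]))
    rw [hnorm] at h1
    by_contra hK
    exact absurd h1 (not_le.2 (div_neg_of_neg_of_pos (not_le.1 hK) (by positivity)))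
  have hcont : Continuous fun x : ℝ => G (x + ε * Complex.I) := by
    refine hd.continuousOn.comp_continuous (by fun_prop) fun x => ?_
    simpa using hε
  have hint : Integrable fun x : ℝ => G (x + ε * Complex.I) := by
    have hi : Integrable fun x : ℝ => max 1 (ε ^ 2)⁻¹ * K * (1 + x ^ 2)⁻¹ :=
      integrable_inv_one_add_sq.const_mul _
    refine hi.mono' hcont.aestronglyMeasurable (ae_of_all _ fun x => ?_)
    refine (hb _ (by rw [him])).trans ?_
    rw [hnorm, div_eq_mul_inv, mul_comm _ K, mul_assoc K]
    gcongr
    rw [← div_eq_mul_inv, le_div_iff₀ (by positivity), inv_mul_le_iff₀ (by positivity)]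
    have h1 : 1 ≤ max 1 (ε ^ 2)⁻¹ := le_max_left _ _
    have h2 : 1 ≤ ε ^ 2 * max 1 (ε ^ 2)⁻¹ := by
      rw [← inv_le_iff_one_le_mul₀' (by positivity)]; exact le_max_right _ _
    nlinarith [mul_le_mul_of_nonneg_left h1 (sq_nonneg x)]
  refine ⟨hint, ?_⟩
  have hlim : Tendsto (fun R : ℝ => ∫ x in (-R)..R, G (x + ε * Complex.I)) atTop
      (𝓝 (∫ x : ℝ, G (x + ε * Complex.I))) :=
    intervalIntegral_tendsto_integral hint tendsto_neg_atTop_atBot tendsto_id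
  refine tendsto_nhds_unique hlim ?_
  refine squeeze_zero_norm' (a := fun R => 4 * K / R) ?_ (tendsto_const_nhds.div_atTop tendsto_id)
  filter_upwards [eventually_gt_atTop 0] with R hR
  -- On the rectangle `[-R, R] × [ε, ε + R]` the top and the two vertical sides have total length
  -- `4R` and lie in `|z| ≥ R`, so they contribute at most `4K/R`.
  have hrect := Complex.integral_boundary_rect_eq_zero_of_differentiableOn G
    ((-R : ℝ) + ε * Complex.I) ((R : ℝ) + (ε + R : ℝ) * Complex.I) (hd.mono (by
      intro z hz
      have h2 := hz.2
      simp only [Set.mem_preimage, him] at h2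
      rw [Set.uIcc_of_le (by linarith)] at h2
      exact hε.trans_le h2.1))
  simp only [hre, him] at hrect
  have bound : ∀ x y : ℝ, ε ≤ y → R ^ 2 ≤ x ^ 2 + y ^ 2 →
      ‖G (x + y * Complex.I)‖ ≤ K / R ^ 2 := by
    intro x y hy h
    refine (hb _ (by rwa [him])).trans ?_
    rw [hnorm]
    gcongr
  have htop : ‖∫ x in (-R)..R, G (x + (ε + R : ℝ) * Complex.I)‖ ≤ K / R ^ 2 * |R - -R| :=
    intervalIntegral.norm_integral_le_of_norm_le_const fun x _ =>
      bound x _ (by linarith) (by nlinarith)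
  have hside : ∀ x : ℝ, x ^ 2 = R ^ 2 →
      ‖∫ y in ε..(ε + R), G (x + y * Complex.I)‖ ≤ K / R ^ 2 * |ε + R - ε| := by
    intro x hx
    refine intervalIntegral.norm_integral_le_of_norm_le_const fun y hy => ?_
    rw [Set.uIoc_of_le (by linarith)] at hy
    exact bound x y hy.1.le (by nlinarith)
  have hr := hside R rfl
  have hl := hside (-R) (by ring)
  rw [sub_neg_eq_add, abs_of_pos (by linarith)] at htop
  rw [add_sub_cancel_left, abs_of_pos hR] at hr hl
  have e : ∫ x in (-R)..R, G (x + ε * Complex.I) =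
      (∫ x in (-R)..R, G (x + (ε + R : ℝ) * Complex.I)) -
      Complex.I • (∫ y in ε..(ε + R), G ((R : ℝ) + y * Complex.I)) +
      Complex.I • (∫ y in ε..(ε + R), G ((-R : ℝ) + y * Complex.I)) := by
    linear_combination hrect
  rw [e]
  calc _ ≤ ‖∫ x in (-R)..R, G (x + (ε + R : ℝ) * Complex.I)‖ +
        ‖∫ y in ε..(ε + R), G ((R : ℝ) + y * Complex.I)‖ +
        ‖∫ y in ε..(ε + R), G ((-R : ℝ) + y * Complex.I)‖ := by
        refine (norm_add_le _ _).trans ?_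
        refine add_le_add ((norm_sub_le _ _).trans ?_) ?_ <;> simp
    _ ≤ K / R ^ 2 * (R + R) + K / R ^ 2 * R + K / R ^ 2 * R := by gcongr
    _ = 4 * K / R := by field_simp; ring

theorem BoundedCompactlySupported.integrable {g : ℝ → ℝ} (hg : BoundedCompactlySupported g) :
    Integrable g := by
  obtain ⟨h1, ⟨M, hM⟩, R, hR⟩ := hg
  have : Integrable ((Set.Icc (-R) R).indicator fun _ => M) :=
    (integrable_indicator_iff measurableSet_Icc).2 (by simp)
  refine this.mono' h1.aestronglyMeasurable (ae_of_all _ fun x => ?_)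
  by_cases hx : |x| ≤ R
  · rw [Set.indicator_of_mem (Set.mem_Icc.2 (abs_le.1 hx))]
    exact hM x
  · rw [hR x (not_le.1 hx), norm_zero]
    exact Set.indicator_nonneg (fun _ _ => (abs_nonneg _).trans (hM x)) _

/-- The Cauchy transform of `g`. -/
noncomputable def cauchyTransform (g : ℝ → ℝ) (z : ℂ) : ℂ := ∫ t, (g t : ℂ) / (z - t)

/-- The Poisson integral of `g` (up to the factor `π`). -/
noncomputable def poissonIntegral (ε : ℝ) (g : ℝ → ℝ) (x : ℝ) : ℝ :=
  ∫ t, g t * (ε / ((x - t) ^ 2 + ε ^ 2))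

/-- The conjugate Poisson integral of `g` (up to the factor `π`). -/
noncomputable def conjPoissonIntegral (ε : ℝ) (g : ℝ → ℝ) (x : ℝ) : ℝ :=
  ∫ t, g t * ((x - t) / ((x - t) ^ 2 + ε ^ 2))

theorem integrable_div_sub {g : ℝ → ℝ} (hg : BoundedCompactlySupported g) {z : ℂ}
    (hz : 0 < z.im) : Integrable fun t => (g t : ℂ) / (z - t) := by
  have hm := hg.1
  refine (hg.integrable.norm.div_const z.im).mono'
    (by fun_prop : Measurable _).aestronglyMeasurable (ae_of_all _ fun t => ?_)
  rw [norm_div, Complex.norm_real]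
  gcongr
  have := Complex.abs_im_le_norm (z - t)
  simp only [Complex.sub_im, Complex.ofReal_im, sub_zero] at this
  exact (le_abs_self _).trans this

theorem integrable_mul_poisson {g : ℝ → ℝ} (hg : BoundedCompactlySupported g) {ε : ℝ}
    (hε : 0 < ε) (x : ℝ) : Integrable fun t => g t * (ε / ((x - t) ^ 2 + ε ^ 2)) := by
  have hm := hg.1
  refine (hg.integrable.norm.mul_const (1 / ε)).mono'
    (by fun_prop : Measurable _).aestronglyMeasurable (ae_of_all _ fun t => ?_)
  rw [norm_mul]
  gcongr
  rw [Real.norm_eq_abs, abs_of_pos (by positivity), div_le_div_iff₀ (by positivity) hε]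
  nlinarith [sq_nonneg (x - t)]

theorem abs_div_sq_add_le {ε : ℝ} (hε : 0 < ε) (y : ℝ) : |y / (y ^ 2 + ε ^ 2)| ≤ 1 / ε := by
  rw [abs_div, abs_of_pos (by positivity : 0 < y ^ 2 + ε ^ 2),
    div_le_div_iff₀ (by positivity) hε, ← sq_abs y]
  nlinarith [sq_nonneg (|y| - ε), abs_nonneg y]

theorem integrable_mul_conjPoisson {g : ℝ → ℝ} (hg : BoundedCompactlySupported g) {ε : ℝ}
    (hε : 0 < ε) (x : ℝ) : Integrable fun t => g t * ((x - t) / ((x - t) ^ 2 + ε ^ 2)) := by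
  have hm := hg.1
  refine (hg.integrable.norm.mul_const (1 / ε)).mono'
    (by fun_prop : Measurable _).aestronglyMeasurable (ae_of_all _ fun t => ?_)
  rw [norm_mul]
  gcongr
  exact abs_div_sq_add_le hε _

/-- This links the complex method to the real operators: the real part is the quantity to be
bounded, and the imaginary part is a convolution already under control. -/
theorem cauchyTransform_eq {g : ℝ → ℝ} (hg : BoundedCompactlySupported g) {ε : ℝ}
    (hε : 0 < ε) (x : ℝ) : cauchyTransform g (x + ε * Complex.I) =
      conjPoissonIntegral ε g x - poissonIntegral ε g x * Complex.I := by
  unfold cauchyTransform conjPoissonIntegral poissonIntegral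
  rw [← integral_complex_ofReal, ← integral_complex_ofReal, ← integral_mul_const, ← integral_sub
    (integrable_mul_conjPoisson hg hε x).ofReal
    ((integrable_mul_poisson hg hε x).ofReal.mul_const _)]
  congr 1 with t
  have h1 : (((x - t) ^ 2 + ε ^ 2 : ℝ) : ℂ) ≠ 0 :=
    Complex.ofReal_ne_zero.2 (by positivity)
  have h2 : (x : ℂ) + ε * Complex.I - t ≠ 0 := by
    intro h
    have := congrArg Complex.im h
    simp at this
    exact hε.ne' this
  push_cast at h1 ⊢
  field_simp
  linear_combination ((ε : ℂ) ^ 2 * g t) * Complex.I_sq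

theorem differentiableOn_cauchyTransform {g : ℝ → ℝ} (hg : BoundedCompactlySupported g) :
    DifferentiableOn ℂ (cauchyTransform g) {z | 0 < z.im} := by
  intro z hz
  have hz : 0 < z.im := hz
  have hm := hg.1
  refine DifferentiableAt.differentiableWithinAt ?_
  have hball : ∀ w ∈ Metric.ball z (z.im / 2), z.im / 2 ≤ w.im := by
    intro w hw
    rw [Metric.mem_ball, dist_eq_norm] at hw
    have := (Complex.abs_im_le_norm (w - z)).trans hw.le
    rw [Complex.sub_im, abs_le] at this
    linarith [this.1]
  have hne : ∀ w : ℂ, z.im / 2 ≤ w.im → ∀ t : ℝ, z.im / 2 ≤ ‖w - t‖ := by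
    intro w hw t
    have := Complex.abs_im_le_norm (w - t)
    simp only [Complex.sub_im, Complex.ofReal_im, sub_zero] at this
    exact hw.trans ((le_abs_self _).trans this)
  have := hasDerivAt_integral_of_dominated_loc_of_deriv_le (μ := volume) (𝕜 := ℂ)
    (F := fun w t => (g t : ℂ) / (w - (t : ℝ))) (F' := fun w t => -(g t : ℂ) / (w - (t : ℝ)) ^ 2)
    (x₀ := z) (s := Metric.ball z (z.im / 2)) (bound := fun t => ‖g t‖ / (z.im / 2) ^ 2)
    (Metric.ball_mem_nhds z (half_pos hz))
    (Eventually.of_forall fun w => (by fun_prop : Measurable _).aestronglyMeasurable)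
    (integrable_div_sub hg hz)
    (by fun_prop : Measurable _).aestronglyMeasurable
    (ae_of_all _ fun t w hw => by
      rw [norm_div, norm_neg, Complex.norm_real, norm_pow]
      have := hne w (hball w hw) t
      gcongr)
    (hg.integrable.norm.div_const _)
    (ae_of_all _ fun t w hw => by
      have h0 : w - (t : ℂ) ≠ 0 := norm_pos_iff.1 ((half_pos hz).trans_le (hne w (hball w hw) t))
      have h1 := (hasDerivAt_const w (g t : ℂ)).fun_div ((hasDerivAt_id' w).sub_const (t : ℂ)) h0
      exact h1.congr_deriv (by simp))
  exact this.2.differentiableAt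

theorem norm_cauchyTransform_le {g : ℝ → ℝ} (hg : BoundedCompactlySupported g) {ε : ℝ}
    (hε : 0 < ε) : ∃ K, 0 ≤ K ∧ ∀ z : ℂ, ε ≤ z.im → ‖cauchyTransform g z‖ ≤ K / ‖z‖ := by
  obtain ⟨R, hR⟩ := hg.2.2
  have hR' : ∀ x, |R| < |x| → g x = 0 := fun x hx => hR x ((le_abs_self R).trans_lt hx)
  refine ⟨(∫ t, ‖g t‖) * (1 + |R| / ε), by positivity, fun z hz => ?_⟩
  have hz0 : 0 < ‖z‖ := hε.trans_le (hz.trans ((le_abs_self _).trans (Complex.abs_im_le_norm z)))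
  rw [mul_div_assoc, ← integral_mul_const]
  refine norm_integral_le_of_norm_le (hg.integrable.norm.mul_const _) (ae_of_all _ fun t => ?_)
  rcases lt_or_ge |R| |t| with ht | ht
  · simp [hR' t ht]
  · have h1 : ε ≤ ‖z - t‖ := by
      have := Complex.abs_im_le_norm (z - t)
      simp only [Complex.sub_im, Complex.ofReal_im, sub_zero] at this
      exact hz.trans ((le_abs_self _).trans this)
    have h2 : ‖z‖ ≤ ‖z - t‖ + |t| := by
      simpa using norm_add_le (z - t) (t : ℂ)
    rw [norm_div, Complex.norm_real, div_eq_mul_inv]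
    gcongr
    rw [inv_le_comm₀ (hε.trans_le h1) (by positivity), inv_div, div_le_iff₀ (by positivity)]
    have h3 : |R| ≤ ‖z - t‖ * (|R| / ε) := by
      rw [mul_div_assoc', le_div_iff₀ hε, mul_comm]
      gcongr
    linarith

/-- Near the real axis `z^n` is close to `(Re z)^n`, so its real part dominates. Elsewhere `|Re z|`
is at most a multiple of `|Im z|`. Applied to the Cauchy transform, the term `Re (z^n)` will
integrate to zero. -/
theorem exists_pow_le_re_pow (n : ℕ) (hn : Even n) (hn0 : n ≠ 0) :
    ∃ C, 0 ≤ C ∧ ∀ z : ℂ, z.re ^ n ≤ 2 * (z ^ n).re + C * z.im ^ n := by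
  have hn1 : (0 : ℝ) < n := by exact_mod_cast Nat.pos_of_ne_zero hn0
  -- Chosen so that `n * (2|Re z|)^(n-1) * δ|Re z|`, the bound for `|z^n - (Re z)^n|`, equals `|Re
  -- z|^n / 2`.
  set δ : ℝ := 1 / (n * 2 ^ n)
  have hδ : 0 < δ := by positivity
  have hδ1 : δ ≤ 1 := by
    rw [div_le_one (by positivity)]
    have : (1 : ℝ) ≤ n := by exact_mod_cast Nat.one_le_iff_ne_zero.2 hn0
    exact one_le_mul_of_one_le_of_one_le this (one_le_pow₀ (by norm_num))
  refine ⟨δ⁻¹ ^ n + 2 * (δ⁻¹ + 1) ^ n, by positivity, fun z => ?_⟩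
  have ha : z.re ^ n = |z.re| ^ n := (hn.pow_abs _).symm
  have hb : z.im ^ n = |z.im| ^ n := (hn.pow_abs _).symm
  have hz : ‖z‖ ≤ |z.re| + |z.im| := Complex.norm_le_abs_re_add_abs_im z
  rw [ha, hb]
  rcases le_or_gt |z.im| (δ * |z.re|) with h | h
  · have h1 : ‖z ^ n - (z.re : ℂ) ^ n‖ ≤ |z.re| ^ n / 2 := by
      have e := (Commute.all z (z.re : ℂ)).geom_sum₂_mul n
      rw [← e, norm_mul]
      have e2 : ‖z - z.re‖ = |z.im| := by
        have : z - z.re = z.im * Complex.I := by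
          apply Complex.ext <;> simp
        rw [this]; simp
      have e3 : ‖∑ i ∈ Finset.range n, z ^ i * (z.re : ℂ) ^ (n - 1 - i)‖ ≤
          n * (2 * |z.re|) ^ (n - 1) := by
        have e4 : n * (2 * |z.re|) ^ (n - 1) =
            ∑ i ∈ Finset.range n, (2 * |z.re|) ^ (n - 1) := by simp
        rw [e4]
        refine norm_sum_le_of_le _ fun i hi => ?_
        rw [norm_mul, norm_pow, norm_pow, Complex.norm_real]
        have hi := Finset.mem_range.1 hi
        have h5 : n - 1 = i + (n - 1 - i) := by omega
        nth_rewrite 2 [h5]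
        rw [pow_add]
        have : ‖z‖ ≤ 2 * |z.re| := by nlinarith [abs_nonneg z.re]
        gcongr
        rw [Real.norm_eq_abs]; linarith [abs_nonneg z.re]
      rw [e2]
      calc _ ≤ n * (2 * |z.re|) ^ (n - 1) * (δ * |z.re|) := by gcongr
        _ = _ := by
          obtain ⟨m, rfl⟩ := Nat.exists_eq_succ_of_ne_zero hn0
          simp only [δ, Nat.succ_eq_add_one, Nat.add_sub_cancel, mul_pow]
          field_simp
          ring
    have h2 := (Complex.abs_re_le_norm _).trans h1
    rw [Complex.sub_re, ← Complex.ofReal_pow, Complex.ofReal_re, ha, abs_le] at h2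
    have : 0 ≤ (δ⁻¹ ^ n + 2 * (δ⁻¹ + 1) ^ n) * |z.im| ^ n := by positivity
    linarith [h2.1]
  · have h1 : |z.re| ≤ δ⁻¹ * |z.im| := by
      rw [← div_eq_inv_mul, le_div_iff₀ hδ]; linarith
    have h2 : |z.re| ^ n ≤ δ⁻¹ ^ n * |z.im| ^ n := by rw [← mul_pow]; gcongr
    have h3 : |(z ^ n).re| ≤ (δ⁻¹ + 1) ^ n * |z.im| ^ n := by
      refine (Complex.abs_re_le_norm _).trans ?_
      rw [norm_pow, ← mul_pow]
      gcongr
      linarith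
    linarith [(abs_le.1 h3).1]

theorem integral_poisson_kernel {ε : ℝ} (hε : 0 < ε) :
    ∫⁻ y, ENNReal.ofReal (ε / (y ^ 2 + ε ^ 2)) = ENNReal.ofReal Real.pi := by
  have e : ∀ y, ε / (y ^ 2 + ε ^ 2) = ε⁻¹ * (1 + (y / ε) ^ 2)⁻¹ := by
    intro y; field_simp; ring
  simp_rw [e]
  have hi : Integrable fun y : ℝ => ε⁻¹ * (1 + (y / ε) ^ 2)⁻¹ :=
    (integrable_inv_one_add_sq.comp_div hε.ne').const_mul _
  rw [← ofReal_integral_eq_lintegral_ofReal hi (ae_of_all _ fun y => by positivity),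
    integral_const_mul, Measure.integral_comp_div (fun y : ℝ => (1 + y ^ 2)⁻¹) ε,
    integral_univ_inv_one_add_sq, abs_of_pos hε, smul_eq_mul, inv_mul_cancel_left₀ hε.ne']

theorem lintegral_poissonIntegral_le {g : ℝ → ℝ} (hg : Measurable g)
    {ε p : ℝ} (hε : 0 < ε) (hp : 1 < p) :
    ∫⁻ x, ENNReal.ofReal (|poissonIntegral ε g x| ^ p) ≤
      ENNReal.ofReal (Real.pi ^ p) * ∫⁻ x, ENNReal.ofReal (|g x| ^ p) := by
  have hp0 : 0 ≤ p := by linarith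
  have h := lintegral_convolution_rpow_le (k := fun y => ENNReal.ofReal (ε / (y ^ 2 + ε ^ 2)))
    (G := fun x => ENNReal.ofReal |g x|) (by fun_prop) (by fun_prop) hp
  rw [integral_poisson_kernel hε] at h
  simp_rw [ENNReal.ofReal_rpow_of_nonneg (abs_nonneg _) hp0] at h
  rw [ENNReal.ofReal_rpow_of_nonneg Real.pi_pos.le hp0] at h
  refine le_trans (lintegral_mono fun x => ?_) h
  rw [← ENNReal.ofReal_rpow_of_nonneg (abs_nonneg _) hp0]
  gcongr
  rw [← Real.enorm_eq_ofReal_abs]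
  refine (enorm_integral_le_lintegral_enorm _).trans_eq ?_
  rw [← lintegral_sub_left_eq_self _ x]
  congr 1 with y
  rw [sub_sub_cancel, enorm_mul, mul_comm, Real.enorm_eq_ofReal_abs, Real.enorm_eq_ofReal_abs,
    abs_of_pos (by positivity : 0 < ε / (y ^ 2 + ε ^ 2))]

/-- The integral of the `n`-th power of the Cauchy transform along height `ε` vanishes, so
`exists_pow_le_re_pow` bounds the conjugate Poisson integral by the Poisson integral in `L^n`. The
latter is a convolution with a kernel of mass `π` at every height, whence the uniformity in `ε`. -/
theorem lintegral_conjPoissonIntegral_even (n : ℕ) (hn : Even n) (hn0 : n ≠ 0) :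
    ∃ C : ℝ≥0∞, C ≠ ⊤ ∧ ∀ ε : ℝ, 0 < ε → ∀ g, BoundedCompactlySupported g →
      ∫⁻ x, ENNReal.ofReal (|conjPoissonIntegral ε g x| ^ (n : ℝ)) ≤
        C * ∫⁻ x, ENNReal.ofReal (|g x| ^ (n : ℝ)) := by
  obtain ⟨C, hC, hpow⟩ := exists_pow_le_re_pow n hn hn0
  have hn2 : 2 ≤ n := by
    obtain ⟨m, rfl⟩ := hn; omega
  refine ⟨ENNReal.ofReal C * ENNReal.ofReal (Real.pi ^ (n : ℝ)), by finiteness,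
    fun ε hε g hg => ?_⟩
  obtain ⟨K, hK, hb⟩ := norm_cauchyTransform_le hg hε
  set F := cauchyTransform g
  -- Two of the `n` factors `1/‖z‖` provide the decay; the others are bounded by `1/ε`.
  have hb2 : ∀ z : ℂ, ε ≤ z.im → ‖F z ^ n‖ ≤ K ^ n / ε ^ (n - 2) / ‖z‖ ^ 2 := by
    intro z hz
    have hz0 : ε ≤ ‖z‖ := hz.trans ((le_abs_self _).trans (Complex.abs_im_le_norm z))
    rw [norm_pow]
    refine (pow_le_pow_left₀ (norm_nonneg _) (hb z hz) n).trans ?_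
    rw [div_pow, div_div]
    have : ‖z‖ ^ n = ‖z‖ ^ (n - 2) * ‖z‖ ^ 2 := by rw [← pow_add]; congr 1; omega
    rw [this]
    have := hε.trans_le hz0
    gcongr
  obtain ⟨hint, hzero⟩ := integral_horizontal_eq_zero (G := fun z => F z ^ n)
    ((differentiableOn_cauchyTransform hg).pow n) hε hb2
  have hre : ∀ x : ℝ, (F (x + ε * Complex.I)).re = conjPoissonIntegral ε g x := by
    intro x; simp only [F]; rw [cauchyTransform_eq hg hε]; simp
  have him : ∀ x : ℝ, (F (x + ε * Complex.I)).im = -poissonIntegral ε g x := by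
    intro x; simp only [F]; rw [cauchyTransform_eq hg hε]; simp
  have hcont : Continuous fun x : ℝ => F (x + ε * Complex.I) := by
    refine (differentiableOn_cauchyTransform hg).continuousOn.comp_continuous (by fun_prop)
      fun x => ?_
    simpa using hε
  have hcV : Continuous (conjPoissonIntegral ε g) := by
    simpa only [hre] using Complex.continuous_re.comp hcont |>.congr hre
  have hcU : Continuous (poissonIntegral ε g) := by
    have := (Complex.continuous_im.comp hcont).neg
    refine this.congr fun x => ?_
    simp [him]
  have hV : Integrable fun x => conjPoissonIntegral ε g x ^ n := by
    refine hint.norm.mono' (hcV.pow n).aestronglyMeasurable (ae_of_all _ fun x => ?_)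
    rw [norm_pow, norm_pow, ← hre]
    exact pow_le_pow_left₀ (norm_nonneg _) (Complex.abs_re_le_norm _) n
  have hU : Integrable fun x => poissonIntegral ε g x ^ n := by
    refine hint.norm.mono' (hcU.pow n).aestronglyMeasurable (ae_of_all _ fun x => ?_)
    rw [norm_pow, norm_pow, ← norm_neg, ← him]
    exact pow_le_pow_left₀ (norm_nonneg _) (Complex.abs_im_le_norm _) n
  have hre0 : ∫ x : ℝ, (F (x + ε * Complex.I) ^ n).re = 0 := by
    have := integral_re hint
    simp only [RCLike.re_to_complex] at this
    rw [this, hzero, Complex.zero_re]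
  have key : ∫ x, conjPoissonIntegral ε g x ^ n ≤ C * ∫ x, poissonIntegral ε g x ^ n := by
    have h1 : ∫ x, conjPoissonIntegral ε g x ^ n ≤
        ∫ x : ℝ, (2 * (F (x + ε * Complex.I) ^ n).re + C * poissonIntegral ε g x ^ n) := by
      refine integral_mono hV ((hint.re.const_mul 2).add (hU.const_mul C)) fun x => ?_
      have := hpow (F (x + ε * Complex.I))
      rw [hre, him, hn.neg_pow] at this
      exact this
    have hre' : Integrable fun x : ℝ => 2 * (F (x + ε * Complex.I) ^ n).re := hint.re.const_mul 2
    rwa [integral_add hre' (hU.const_mul C), integral_const_mul, integral_const_mul, hre0,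
      mul_zero, zero_add] at h1
  have conv : ∀ h : ℝ → ℝ, Integrable (fun x => h x ^ n) →
      ∫⁻ x, ENNReal.ofReal (|h x| ^ (n : ℝ)) = ENNReal.ofReal (∫ x, h x ^ n) := by
    intro h hh
    rw [ofReal_integral_eq_lintegral_ofReal hh (ae_of_all _ fun x => hn.pow_nonneg _)]
    congr 1 with x
    rw [Real.rpow_natCast, hn.pow_abs]
  have hn1 : (1 : ℝ) < n := by exact_mod_cast hn2
  calc _ = ENNReal.ofReal (∫ x, conjPoissonIntegral ε g x ^ n) := conv _ hV
    _ ≤ ENNReal.ofReal (C * ∫ x, poissonIntegral ε g x ^ n) := ENNReal.ofReal_le_ofReal key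
    _ = ENNReal.ofReal C * ∫⁻ x, ENNReal.ofReal (|poissonIntegral ε g x| ^ (n : ℝ)) := by
        rw [ENNReal.ofReal_mul hC, conv _ hU]
    _ ≤ _ := by
        rw [mul_assoc]
        gcongr
        exact lintegral_poissonIntegral_le hg.1 hε hn1

theorem measurable_conjPoissonIntegral {g : ℝ → ℝ} (hg : Measurable g) (ε : ℝ) :
    Measurable (conjPoissonIntegral ε g) := by
  have : Measurable (Function.uncurry fun x t : ℝ => g t * ((x - t) / ((x - t) ^ 2 + ε ^ 2))) := by
    unfold Function.uncurry; fun_prop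
  exact this.stronglyMeasurable.integral_prod_right.measurable

/-- The conjugate Poisson integrals are bounded on `L^p`, uniformly in the height. -/
theorem lintegral_conjPoissonIntegral {p : ℝ} (hp : 2 ≤ p) :
    ∃ C : ℝ≥0∞, C ≠ ⊤ ∧ ∀ ε : ℝ, 0 < ε → ∀ g, BoundedCompactlySupported g →
      ∫⁻ x, ENNReal.ofReal (|conjPoissonIntegral ε g x| ^ p) ≤
        C * ∫⁻ x, ENNReal.ofReal (|g x| ^ p) := by
  obtain ⟨A, hA, hA'⟩ := lintegral_conjPoissonIntegral_even 2 even_two two_ne_zero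
  rcases hp.eq_or_lt with rfl | hp
  · exact ⟨A, hA, hA'⟩
  -- The upper endpoint of the interpolation is the even integer `2k > p`.
  obtain ⟨k, hk⟩ := exists_nat_gt p
  have hk0 : k ≠ 0 := by
    rintro rfl
    norm_num at hk; linarith
  obtain ⟨B, hB, hB'⟩ := lintegral_conjPoissonIntegral_even (k + k) ⟨k, rfl⟩ (by omega)
  obtain ⟨C, hC, h⟩ := marcinkiewicz (q₀ := (2 : ℕ)) (p := p) (q₁ := (k + k : ℕ)) (by norm_num)
    (by exact_mod_cast hp) (by push_cast; linarith) hA hB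
  refine ⟨C, hC, fun ε hε g hg => h (conjPoissonIntegral ε)
    (fun g hg => measurable_conjPoissonIntegral hg.1 ε) (fun g h hg hh x => ?_)
    (hA' ε hε) (hB' ε hε) g hg⟩
  unfold conjPoissonIntegral
  rw [← integral_add (integrable_mul_conjPoisson hg hε x) (integrable_mul_conjPoisson hh hε x)]
  simp only [Pi.add_apply, add_mul]

/-! ### The localized Hilbert transform on `L^p`. -/

/-- The kernel `1 / y - y / (1 + y²)` of the localized Hilbert transform. -/
noncomputable def hilbertKernel (y : ℝ) : ℝ := 1 / (y * (1 + y ^ 2))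

/-- The localized Hilbert transform. -/
noncomputable def localHilbert (g : ℝ → ℝ) (x : ℝ) : ℝ :=
  ∫ y, hilbertKernel y * (g (x - y) - g (x + y))

theorem IsTestFunction.boundedCompactlySupported {g : ℝ → ℝ} (hg : IsTestFunction g) :
    BoundedCompactlySupported g := by
  obtain ⟨M, -, hM⟩ := hg.exists_abs_le
  obtain ⟨R, -, hR⟩ := hg.exists_support
  exact ⟨hg.continuous.measurable, ⟨M, hM⟩, R, hR⟩

theorem IsTestFunction.exists_difference_le {g : ℝ → ℝ} (hg : IsTestFunction g) :
    ∃ L, 0 ≤ L ∧ ∀ x y, |g (x - y) - g (x + y)| ≤ L * |y| := by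
  obtain ⟨L, hL, h⟩ := hg.exists_lipschitz
  refine ⟨2 * L, by positivity, fun x y => (h _ _).trans_eq ?_⟩
  rw [show x - y - (x + y) = -(2 * y) by ring, abs_neg, abs_mul, abs_two]; ring

theorem abs_mul_hilbertKernel_le (y : ℝ) : |y| * |hilbertKernel y| ≤ (1 + y ^ 2)⁻¹ := by
  rcases eq_or_ne y 0 with rfl | hy
  · simp
  · rw [← abs_mul, hilbertKernel, abs_of_pos]
    · apply le_of_eq; field_simp
    · have : y * (1 / (y * (1 + y ^ 2))) = (1 + y ^ 2)⁻¹ := by field_simp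
      rw [this]; positivity

theorem integrable_localHilbert {g : ℝ → ℝ} (hg : IsTestFunction g) (x : ℝ) :
    Integrable fun y => hilbertKernel y * (g (x - y) - g (x + y)) := by
  obtain ⟨L, hL, h⟩ := hg.exists_difference_le
  have hm := hg.continuous.measurable
  refine (integrable_inv_one_add_sq.const_mul L).mono' ?_ (ae_of_all _ fun y => ?_)
  · unfold hilbertKernel
    exact (by fun_prop : Measurable _).aestronglyMeasurable
  · rw [norm_mul, Real.norm_eq_abs, Real.norm_eq_abs]
    calc _ ≤ |hilbertKernel y| * (L * |y|) := by gcongr; exact h x y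
      _ = L * (|y| * |hilbertKernel y|) := by ring
      _ ≤ _ := by gcongr; exact abs_mul_hilbertKernel_le y

theorem conjPoissonIntegral_eq_symm {g : ℝ → ℝ} (hg : BoundedCompactlySupported g) {ε : ℝ}
    (hε : 0 < ε) (x : ℝ) :
    Integrable (fun y => y / (y ^ 2 + ε ^ 2) * (g (x - y) - g (x + y))) ∧
    2 * conjPoissonIntegral ε g x = ∫ y, y / (y ^ 2 + ε ^ 2) * (g (x - y) - g (x + y)) := by
  have hi := (integrable_mul_conjPoisson hg hε x).comp_sub_left x
  simp only [sub_sub_cancel] at hi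
  have e : ∀ y, y / (y ^ 2 + ε ^ 2) * (g (x - y) - g (x + y)) =
      g (x - y) * (y / (y ^ 2 + ε ^ 2)) + g (x - -y) * (-y / ((-y) ^ 2 + ε ^ 2)) := by
    intro y
    rw [sub_neg_eq_add, neg_sq]; ring
  simp_rw [e]
  refine ⟨hi.add hi.comp_neg, ?_⟩
  rw [integral_add hi hi.comp_neg,
    integral_neg_eq_self (fun y => g (x - y) * (y / (y ^ 2 + ε ^ 2)))]
  have : conjPoissonIntegral ε g x = ∫ y, g (x - y) * (y / (y ^ 2 + ε ^ 2)) := by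
    rw [conjPoissonIntegral, ← integral_sub_left_eq_self _ _ x]
    simp
  rw [this]; ring

/-- Subtracting the integral at height `1` removes the tail of `1/y`. For `ε ≤ 1` the difference of
the kernels is dominated by `|hilbertKernel|`, and the Lipschitz bound on `g` absorbs the
singularity at `0`. The factor `2` comes from the symmetrization. -/
theorem tendsto_conjPoissonIntegral {g : ℝ → ℝ} (hg : IsTestFunction g) (x : ℝ) :
    Tendsto (fun ε => 2 * (conjPoissonIntegral ε g x - conjPoissonIntegral 1 g x)) (𝓝[>] 0)
      (𝓝 (localHilbert g x)) := by
  obtain ⟨L, hL, h⟩ := hg.exists_difference_le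
  have hb := hg.boundedCompactlySupported
  obtain ⟨i1, e1⟩ := conjPoissonIntegral_eq_symm hb one_pos x
  have key : Tendsto (fun ε : ℝ => ∫ y, (y / (y ^ 2 + ε ^ 2) * (g (x - y) - g (x + y)) -
      y / (y ^ 2 + 1 ^ 2) * (g (x - y) - g (x + y)))) (𝓝[>] 0) (𝓝 (localHilbert g x)) := by
    refine tendsto_integral_filter_of_dominated_convergence (fun y => L * (1 + y ^ 2)⁻¹) ?_ ?_
      (integrable_inv_one_add_sq.const_mul L) ?_
    · have hm := hg.continuous.measurable
      exact Eventually.of_forall fun ε => (by fun_prop : Measurable _).aestronglyMeasurable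
    · filter_upwards [Ioc_mem_nhdsGT (zero_lt_one (α := ℝ))] with ε hε
      have hε0 : 0 < ε := hε.1
      refine ae_of_all _ fun y => ?_
      rw [← sub_mul, norm_mul, Real.norm_eq_abs, Real.norm_eq_abs]
      have h1 : |y / (y ^ 2 + ε ^ 2) - y / (y ^ 2 + 1 ^ 2)| ≤ |hilbertKernel y| := by
        rcases eq_or_ne y 0 with rfl | hy
        · simp
        have hy2 : 0 < y ^ 2 := by positivity
        have hε2 : ε ^ 2 ≤ 1 := pow_le_one₀ hε0.le hε.2
        have e : y / (y ^ 2 + ε ^ 2) - y / (y ^ 2 + 1 ^ 2) =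
            hilbertKernel y * (y ^ 2 * (1 - ε ^ 2) / (y ^ 2 + ε ^ 2)) := by
          unfold hilbertKernel; field_simp; ring
        rw [e, abs_mul]
        refine mul_le_of_le_one_right (abs_nonneg _) ?_
        rw [abs_of_nonneg (by have : 0 ≤ 1 - ε ^ 2 := by linarith
                              positivity), div_le_one (by positivity)]
        nlinarith [sq_nonneg ε]
      calc _ ≤ |hilbertKernel y| * (L * |y|) := by gcongr; exact h x y
        _ = L * (|y| * |hilbertKernel y|) := by ring
        _ ≤ _ := by gcongr; exact abs_mul_hilbertKernel_le y
    · filter_upwards [compl_mem_ae_iff.2 (measure_singleton (0 : ℝ))] with y hy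
      have hy : y ≠ 0 := hy
      -- Written with `0 ^ 2`, the limit is the value at `ε = 0` of an expression continuous there,
      -- since `y ≠ 0`.
      have e : hilbertKernel y * (g (x - y) - g (x + y)) =
          y / (y ^ 2 + 0 ^ 2) * (g (x - y) - g (x + y)) -
          y / (y ^ 2 + 1 ^ 2) * (g (x - y) - g (x + y)) := by
        unfold hilbertKernel; field_simp; ring
      rw [e]
      refine tendsto_nhdsWithin_of_tendsto_nhds (ContinuousAt.tendsto ?_)
      have : y ^ 2 + 0 ^ 2 ≠ 0 := by positivity
      fun_prop (disch := assumption)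
  refine key.congr' ?_
  filter_upwards [self_mem_nhdsWithin] with ε hε
  obtain ⟨i2, e2⟩ := conjPoissonIntegral_eq_symm hb hε x
  rw [integral_sub i2 i1, ← e1, ← e2]
  ring

/-- The localized Hilbert transform is bounded on `L^p`. -/
theorem lintegral_localHilbert {p : ℝ} (hp : 2 ≤ p) :
    ∃ C : ℝ≥0∞, C ≠ ⊤ ∧ ∀ g, IsTestFunction g →
      ∫⁻ x, ENNReal.ofReal (|localHilbert g x| ^ p) ≤
        C * ∫⁻ x, ENNReal.ofReal (|g x| ^ p) := by
  obtain ⟨C, hC, h⟩ := lintegral_conjPoissonIntegral hp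
  have hp0 : 0 < p := by linarith
  refine ⟨ENNReal.ofReal (4 ^ p) * (C + C), by finiteness, fun g hg => ?_⟩
  have hb := hg.boundedCompactlySupported
  set u : ℕ → ℝ := fun n => 1 / ((n : ℝ) + 1)
  have hu : Tendsto u atTop (𝓝[>] 0) := by
    refine tendsto_nhdsWithin_iff.2 ⟨tendsto_one_div_add_atTop_nhds_zero_nat,
      Eventually.of_forall fun n => ?_⟩
    exact (Nat.one_div_pos_of_nat : (0 : ℝ) < u n)
  have hpos : ∀ n, 0 < u n := fun n => Nat.one_div_pos_of_nat
  have hm : ∀ n, Measurable fun x => ENNReal.ofReal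
      (|2 * (conjPoissonIntegral (u n) g x - conjPoissonIntegral 1 g x)| ^ p) := by
    intro n
    have h1 := measurable_conjPoissonIntegral hb.1 (u n)
    have h2 := measurable_conjPoissonIntegral hb.1 1
    fun_prop
  have hlim : ∀ x, ENNReal.ofReal (|localHilbert g x| ^ p) = liminf (fun n => ENNReal.ofReal
      (|2 * (conjPoissonIntegral (u n) g x - conjPoissonIntegral 1 g x)| ^ p)) atTop := by
    intro x
    refine (Tendsto.liminf_eq ?_).symm
    refine ENNReal.tendsto_ofReal (Tendsto.rpow_const ?_ (Or.inr hp0.le))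
    exact ((tendsto_conjPoissonIntegral hg x).comp hu).abs
  simp_rw [hlim]
  refine (lintegral_liminf_le hm).trans ?_
  -- After Fatou, a lower bound valid eventually holds for some `n`, and the estimate at that single
  -- height is enough because it is uniform.
  refine liminf_le_of_le (by isBoundedDefault) fun b hb' => ?_
  obtain ⟨n, hn⟩ := hb'.exists
  refine hn.trans ?_
  calc _ ≤ ∫⁻ x, ENNReal.ofReal (4 ^ p) * (ENNReal.ofReal (|conjPoissonIntegral (u n) g x| ^ p) +
        ENNReal.ofReal (|conjPoissonIntegral 1 g x| ^ p)) := by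
        refine lintegral_mono fun x => ?_
        rw [← ENNReal.ofReal_add (by positivity) (by positivity),
          ← ENNReal.ofReal_mul (by positivity)]
        refine ENNReal.ofReal_le_ofReal ?_
        set a := conjPoissonIntegral (u n) g x
        set b := conjPoissonIntegral 1 g x
        have h1 : |2 * (a - b)| ≤ 4 * max |a| |b| := by
          rw [abs_mul, abs_two]
          linarith [abs_sub a b, le_max_left |a| |b|, le_max_right |a| |b|]
        calc _ ≤ (4 * max |a| |b|) ^ p := by gcongr
          _ = 4 ^ p * max |a| |b| ^ p := Real.mul_rpow (by norm_num) (by positivity)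
          _ ≤ _ := by
            gcongr
            rcases max_cases |a| |b| with ⟨e, -⟩ | ⟨e, -⟩ <;> rw [e]
            · exact le_add_of_nonneg_right (by positivity)
            · exact le_add_of_nonneg_left (by positivity)
    _ ≤ _ := by
        have h1 := measurable_conjPoissonIntegral hb.1 (u n)
        rw [lintegral_const_mul' _ _ (by finiteness), lintegral_add_left (by fun_prop), mul_assoc,
          add_mul]
        gcongr
        · exact h _ (hpos n) g hb
        · exact h _ one_pos g hb

/-! ### Estimates for the conjugated commutator kernel. -/

theorem abs_rpow_sub_one_le (b : ℝ) :
    ∃ L, 0 ≤ L ∧ ∀ r, r ∈ Set.Icc (1 / 4 : ℝ) 4 → |r ^ b - 1| ≤ L * |r - 1| := by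
  refine ⟨|b| * 4 ^ |b - 1|, by positivity, fun r hr => ?_⟩
  have h := Convex.norm_image_sub_le_of_norm_hasDerivWithin_le (s := Set.Icc (1 / 4 : ℝ) 4)
    (f := fun t => t ^ b) (f' := fun t => b * t ^ (b - 1)) (C := |b| * 4 ^ |b - 1|) (x := 1) (y := r)
    (fun t ht => (Real.hasDerivAt_rpow_const (Or.inl (by linarith [ht.1]))).hasDerivWithinAt)
    (fun t ht => by
      have ht0 : 0 < t := by linarith [ht.1]
      rw [norm_mul, Real.norm_eq_abs, Real.norm_eq_abs, abs_of_pos (Real.rpow_pos_of_pos ht0 _)]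
      gcongr
      rcases le_total 0 (b - 1) with hb | hb
      · rw [abs_of_nonneg hb]
        gcongr
        exact ht.2
      · rw [abs_of_nonpos hb, ← inv_inv t, Real.inv_rpow (by positivity), ← Real.rpow_neg (by positivity)]
        have : t⁻¹ ≤ 4 := by
          rw [inv_le_comm₀ ht0 (by norm_num)]; linarith [ht.1]
        exact Real.rpow_le_rpow (by positivity) this (by linarith))
    (convex_Icc _ _) ⟨by norm_num, by norm_num⟩ hr
  simpa using h

/-- Mean value inequality for the remainder: its derivative `a * (t^(a-1) - 1)` is already `O(|r -
1|)` between `1` and `r`. -/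
theorem abs_rpow_sub_linear_le (a : ℝ) :
    ∃ L, 0 ≤ L ∧ ∀ r, r ∈ Set.Icc (1 / 4 : ℝ) 4 → |r ^ a - 1 - a * (r - 1)| ≤ L * (r - 1) ^ 2 := by
  obtain ⟨L, hL, h⟩ := abs_rpow_sub_one_le (a - 1)
  refine ⟨|a| * L, by positivity, fun r hr => ?_⟩
  have hsub : Set.uIcc 1 r ⊆ Set.Icc (1 / 4 : ℝ) 4 :=
    Set.uIcc_subset_Icc ⟨by norm_num, by norm_num⟩ hr
  have h := Convex.norm_image_sub_le_of_norm_hasDerivWithin_le (s := Set.uIcc 1 r)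
    (f := fun t => t ^ a - 1 - a * (t - 1)) (f' := fun t => a * t ^ (a - 1) - a * 1)
    (C := |a| * (L * |r - 1|)) (x := 1) (y := r)
    (fun t ht => (((Real.hasDerivAt_rpow_const (Or.inl (by linarith [(hsub ht).1]))).sub_const
      1).sub (((hasDerivAt_id t).sub_const 1).const_mul a)).hasDerivWithinAt)
    (fun t ht => by
      rw [← mul_sub, norm_mul, Real.norm_eq_abs, Real.norm_eq_abs]
      refine mul_le_mul_of_nonneg_left ((h t (hsub ht)).trans ?_) (abs_nonneg _)
      exact mul_le_mul_of_nonneg_left (Set.abs_sub_left_of_mem_uIcc ht) hL)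
    (convex_uIcc _ _) Set.left_mem_uIcc Set.right_mem_uIcc
  simp only [Real.one_rpow, sub_self, mul_zero, sub_zero, Real.norm_eq_abs] at h
  refine h.trans_eq ?_
  rw [← sq_abs (r - 1)]; ring

theorem rpow_le_rpow_abs {r D a μ : ℝ} (hr : 0 < r) (hD : 1 ≤ D) (h1 : r ≤ D) (h2 : r⁻¹ ≤ D)
    (hμ : |a| ≤ μ) : r ^ a ≤ D ^ μ := by
  refine le_trans ?_ (Real.rpow_le_rpow_of_exponent_le hD hμ)
  rcases le_total 0 a with ha | ha
  · rw [abs_of_nonneg ha]; gcongr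
  · rw [abs_of_nonpos ha, ← inv_inv r, Real.inv_rpow (by positivity),
      ← Real.rpow_neg (by positivity)]
    exact Real.rpow_le_rpow (by positivity) h2 (by linarith)

/-- The ratio `(1 + (x - y)²) / (1 + x²)`. -/
noncomputable def bracketRatio (x y : ℝ) : ℝ := (1 + (x - y) ^ 2) / (1 + x ^ 2)

theorem bracketRatio_pos (x y : ℝ) : 0 < bracketRatio x y := by unfold bracketRatio; positivity

theorem bracketRatio_le (x y : ℝ) : bracketRatio x y ≤ 2 * (1 + y ^ 2) := by
  unfold bracketRatio
  rw [div_le_iff₀ (by positivity)]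
  nlinarith [sq_nonneg (x + y), mul_nonneg (sq_nonneg x) (sq_nonneg y)]

theorem inv_bracketRatio_le (x y : ℝ) : (bracketRatio x y)⁻¹ ≤ 2 * (1 + y ^ 2) := by
  unfold bracketRatio
  rw [inv_div, div_le_iff₀ (by positivity)]
  nlinarith [sq_nonneg (x - 2 * y), mul_nonneg (sq_nonneg (x - y)) (sq_nonneg y)]

theorem bracketRatio_sub_one (x y : ℝ) :
    bracketRatio x y - 1 = (y ^ 2 - 2 * x * y) / (1 + x ^ 2) := by
  unfold bracketRatio
  field_simp
  ring

theorem abs_bracketRatio_sub_one_le {x y : ℝ} (hy : |y| ≤ 1) :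
    |bracketRatio x y - 1| ≤ 2 * |y| := by
  rw [bracketRatio_sub_one, abs_div, abs_of_pos (by positivity : 0 < 1 + x ^ 2),
    div_le_iff₀ (by positivity)]
  have h1 : |y ^ 2 - 2 * x * y| ≤ |y| * (|y| + 2 * |x|) := by
    refine (abs_sub _ _).trans_eq ?_
    rw [abs_mul, abs_mul, abs_two, abs_pow]; ring
  refine h1.trans ?_
  rw [← sq_abs x]
  nlinarith [abs_nonneg y, abs_nonneg x, mul_nonneg (abs_nonneg y) (sq_nonneg (2 * |x| - 1))]

/-- This keeps the ratio in the compact interval where the expansions of `r ^ a` around `1` are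
uniform in `x`. -/
theorem bracketRatio_mem {x y : ℝ} (hy : |y| ≤ 1) : bracketRatio x y ∈ Set.Icc (1 / 4 : ℝ) 4 := by
  have hy2 : y ^ 2 ≤ 1 := by rw [← sq_abs]; exact pow_le_one₀ (abs_nonneg y) hy
  have h1 := bracketRatio_le x y
  have h2 := inv_bracketRatio_le x y
  refine ⟨?_, by linarith⟩
  rw [one_div, inv_le_comm₀ (by norm_num) (bracketRatio_pos x y)]
  linarith

/-- The kernel of the conjugated commutator. -/
noncomputable def commutatorKernel (α a c x y : ℝ) : ℝ :=
  (bracketRatio x y ^ a - bracketRatio x y ^ c) / |y| ^ (1 + α)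

theorem abs_commutatorKernel_far {α a c μ x y : ℝ} (ha : |a| ≤ μ) (hc : |c| ≤ μ) (hy : 1 < |y|) :
    |commutatorKernel α a c x y| ≤ 2 * 4 ^ μ * |y| ^ (2 * μ - (1 + α)) := by
  have hy0 : 0 < |y| := zero_lt_one.trans hy
  have hy2 : 1 ≤ y ^ 2 := by rw [← sq_abs]; exact one_le_pow₀ hy.le
  have hr := bracketRatio_pos x y
  have h1 : bracketRatio x y ≤ 4 * y ^ 2 := (bracketRatio_le x y).trans (by linarith)
  have h2 : (bracketRatio x y)⁻¹ ≤ 4 * y ^ 2 := (inv_bracketRatio_le x y).trans (by linarith)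
  have h3 := rpow_le_rpow_abs hr (by linarith) h1 h2 ha
  have h4 := rpow_le_rpow_abs hr (by linarith) h1 h2 hc
  have e : (4 * y ^ 2) ^ μ = 4 ^ μ * |y| ^ (2 * μ) := by
    rw [Real.mul_rpow (by norm_num) (sq_nonneg y), ← sq_abs, ← Real.rpow_natCast |y|,
      ← Real.rpow_mul hy0.le]
    norm_num
  have h5 : |bracketRatio x y ^ a - bracketRatio x y ^ c| ≤ 2 * (4 * y ^ 2) ^ μ := by
    have := (Real.rpow_pos_of_pos hr a).le
    have := (Real.rpow_pos_of_pos hr c).le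
    rw [abs_le]; constructor <;> linarith
  rw [commutatorKernel, abs_div, abs_of_nonneg (Real.rpow_nonneg hy0.le _), Real.rpow_sub hy0,
    mul_div_assoc', mul_assoc 2, ← e]
  gcongr

/-- Both powers equal `1` at `y = 0`, so their difference gains a factor `|y|` near the origin. For
`α < 1` this makes the kernel locally integrable. -/
theorem exists_commutatorKernel_le {α a c μ : ℝ} (ha : |a| ≤ μ) (hc : |c| ≤ μ) :
    ∃ K, 0 ≤ K ∧ ∀ x y, y ≠ 0 →
      |commutatorKernel α a c x y| ≤ K * powKernel (-α) (2 * μ - (1 + α)) y := by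
  obtain ⟨L, hL, h⟩ := abs_rpow_sub_one_le a
  obtain ⟨L', hL', h'⟩ := abs_rpow_sub_one_le c
  refine ⟨max (2 * (L + L')) (2 * 4 ^ μ), by positivity, fun x y hy => ?_⟩
  have hy0 : 0 < |y| := abs_pos.2 hy
  unfold powKernel
  split_ifs with hy1
  · have h1 := h _ (bracketRatio_mem (x := x) hy1)
    have h2 := h' _ (bracketRatio_mem (x := x) hy1)
    have h3 := abs_bracketRatio_sub_one_le (x := x) hy1
    have h4 : |bracketRatio x y ^ a - bracketRatio x y ^ c| ≤ 2 * (L + L') * |y| := by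
      have e : bracketRatio x y ^ a - bracketRatio x y ^ c =
        (bracketRatio x y ^ a - 1) - (bracketRatio x y ^ c - 1) := by ring
      rw [e]
      refine (abs_sub _ _).trans ?_
      nlinarith
    rw [commutatorKernel, abs_div, abs_of_nonneg (Real.rpow_nonneg hy0.le _)]
    calc _ ≤ 2 * (L + L') * |y| / |y| ^ (1 + α) := by gcongr
      _ = 2 * (L + L') * |y| ^ (-α) := by
        rw [show -α = 1 - (1 + α) by ring, Real.rpow_sub hy0, Real.rpow_one, mul_div_assoc]
      _ ≤ _ := by gcongr; exact le_max_left _ _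
  · refine (abs_commutatorKernel_far ha hc (not_le.1 hy1)).trans ?_
    gcongr
    exact le_max_right _ _

theorem abs_div_one_add_sq_le (x : ℝ) : |x / (1 + x ^ 2)| ≤ 1 := by
  rw [abs_div, abs_of_pos (by positivity : 0 < 1 + x ^ 2), div_le_one (by positivity), ← sq_abs]
  nlinarith [sq_nonneg (|x| - 1), abs_nonneg x]

/-- To first order `r^a - r^c` is `(a - c)(r - 1)`, and `r - 1 = (y² - 2xy)/(1 + x²)`. Dividing by
`y²` leaves the singular term `-2(a - c) x/(1 + x²) * (1/y)`; everything else is bounded near `0`.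
-/
theorem exists_commutatorKernel_sub_hilbertKernel_le {a c μ : ℝ} (ha : |a| ≤ μ) (hc : |c| ≤ μ) :
    ∃ K, 0 ≤ K ∧ ∀ x y, y ≠ 0 →
      |commutatorKernel 1 a c x y - -2 * (a - c) * (x / (1 + x ^ 2)) * hilbertKernel y| ≤
        K * powKernel 0 (2 * μ - 2) y := by
  obtain ⟨L, hL, h⟩ := abs_rpow_sub_linear_le a
  obtain ⟨L', hL', h'⟩ := abs_rpow_sub_linear_le c
  have hμ : 0 ≤ μ := (abs_nonneg _).trans ha
  refine ⟨max (4 * (L + L') + 3 * |a - c|) (2 * 4 ^ μ + 2 * |a - c|), by positivity,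
    fun x y hy => ?_⟩
  have hy0 : 0 < |y| := abs_pos.2 hy
  have hx := abs_div_one_add_sq_le x
  unfold powKernel
  split_ifs with hy1
  · have h1 := h _ (bracketRatio_mem (x := x) hy1)
    have h2 := h' _ (bracketRatio_mem (x := x) hy1)
    have h3 : (bracketRatio x y - 1) ^ 2 ≤ 4 * y ^ 2 := by
      rw [← sq_abs, ← sq_abs y]
      nlinarith [abs_bracketRatio_sub_one_le (x := x) hy1, abs_nonneg (bracketRatio x y - 1)]
    set r := bracketRatio x y with hr
    -- The three terms are the Taylor remainders, the `y²` part of `r - 1`, and the discrepancy `1/y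
    -- - hilbertKernel y = y/(1 + y²)`.
    have e : commutatorKernel 1 a c x y - -2 * (a - c) * (x / (1 + x ^ 2)) * hilbertKernel y =
        ((r ^ a - 1 - a * (r - 1)) - (r ^ c - 1 - c * (r - 1))) / y ^ 2 +
        (a - c) * (1 / (1 + x ^ 2)) - 2 * (a - c) * (x / (1 + x ^ 2)) * (y / (1 + y ^ 2)) := by
      have e1 : r - 1 = (y ^ 2 - 2 * x * y) / (1 + x ^ 2) := bracketRatio_sub_one x y
      have e2 : (r ^ a - 1 - a * (r - 1)) - (r ^ c - 1 - c * (r - 1)) =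
          r ^ a - r ^ c - (a - c) * (r - 1) := by ring
      have e3 : |y| ^ (1 + 1 : ℝ) = y ^ 2 := by
        rw [← sq_abs, ← Real.rpow_natCast]; norm_num
      rw [e2, e1, commutatorKernel, ← hr, e3, hilbertKernel]
      field_simp
      ring
    rw [e, Real.rpow_zero, mul_one]
    refine le_trans ?_ (le_max_left _ _)
    have b1 : |((r ^ a - 1 - a * (r - 1)) - (r ^ c - 1 - c * (r - 1))) / y ^ 2| ≤
        4 * (L + L') := by
      rw [abs_div, abs_of_nonneg (sq_nonneg y), div_le_iff₀ (by positivity)]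
      refine (abs_sub _ _).trans ?_
      nlinarith
    have b2 : |(a - c) * (1 / (1 + x ^ 2))| ≤ |a - c| := by
      rw [abs_mul]
      refine mul_le_of_le_one_right (abs_nonneg _) ?_
      rw [abs_of_pos (by positivity), div_le_one (by positivity)]
      nlinarith [sq_nonneg x]
    have b3 : |2 * (a - c) * (x / (1 + x ^ 2)) * (y / (1 + y ^ 2))| ≤ 2 * |a - c| := by
      rw [abs_mul, abs_mul, abs_mul, abs_two]
      calc 2 * |a - c| * |x / (1 + x ^ 2)| * |y / (1 + y ^ 2)| ≤ 2 * |a - c| * 1 * 1 := by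
            gcongr
            exact abs_div_one_add_sq_le y
        _ = _ := by ring
    calc _ ≤ _ := (abs_sub _ _).trans (add_le_add_left (abs_add_le _ _) _)
      _ ≤ 4 * (L + L') + |a - c| + 2 * |a - c| := by gcongr
      _ = _ := by ring
  · have hy1 := not_le.1 hy1
    have b1 := abs_commutatorKernel_far (α := 1) (x := x) ha hc hy1
    rw [show 2 * μ - (1 + 1) = 2 * μ - 2 by norm_num] at b1
    have b2 : |hilbertKernel y| ≤ |y| ^ (2 * μ - 2) := by
      have h1 : |hilbertKernel y| ≤ (1 + y ^ 2)⁻¹ :=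
        (le_mul_of_one_le_left (abs_nonneg _) hy1.le).trans (abs_mul_hilbertKernel_le y)
      have h2 : (1 + y ^ 2)⁻¹ ≤ |y| ^ (-2 : ℝ) := by
        rw [Real.rpow_neg hy0.le]
        have : |y| ^ (2 : ℝ) = y ^ 2 := by rw [← sq_abs, ← Real.rpow_natCast]; norm_num
        rw [this]
        have : 0 < y ^ 2 := by positivity
        gcongr
        linarith
      exact h1.trans (h2.trans (Real.rpow_le_rpow_of_exponent_le hy1.le (by linarith)))
    have b3 : |-2 * (a - c) * (x / (1 + x ^ 2)) * hilbertKernel y| ≤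
        2 * |a - c| * |y| ^ (2 * μ - 2) := by
      rw [abs_mul, abs_mul, abs_mul, abs_neg, abs_two]
      calc _ ≤ 2 * |a - c| * 1 * |y| ^ (2 * μ - 2) := by gcongr
        _ = _ := by ring
    calc _ ≤ _ := abs_sub _ _
      _ ≤ (2 * 4 ^ μ + 2 * |a - c|) * |y| ^ (2 * μ - 2) := by rw [add_mul]; gcongr
      _ ≤ _ := by gcongr; exact le_max_right _ _

/-! ### Operators with a Hilbert-type kernel on `L^p`. -/

theorem hilbertKernel_neg (y : ℝ) : hilbertKernel (-y) = -hilbertKernel y := by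
  simp [hilbertKernel, div_neg]

theorem add_three_rpow_le (a b c : ℝ≥0∞) {p : ℝ} (hp : 0 ≤ p) :
    (a + b + c) ^ p ≤ 3 ^ p * (a ^ p + b ^ p + c ^ p) := by
  have h : a + b + c ≤ 3 * max (max a b) c := by
    have h1 : a ≤ max (max a b) c := (le_max_left _ _).trans (le_max_left _ _)
    have h2 : b ≤ max (max a b) c := (le_max_right _ _).trans (le_max_left _ _)
    have h3 : c ≤ max (max a b) c := le_max_right _ _
    calc a + b + c ≤ _ := add_le_add (add_le_add h1 h2) h3
      _ = _ := by ring
  refine (ENNReal.rpow_le_rpow h hp).trans ?_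
  rw [ENNReal.mul_rpow_of_nonneg _ _ hp]
  gcongr
  rcases max_choice (max a b) c with e | e <;> rw [e]
  · rcases max_choice a b with e' | e' <;> rw [e']
    · rw [add_assoc]; exact le_self_add
    · rw [add_right_comm]; exact le_add_self
  · exact le_add_self

/-- An operator whose kernel differs from a bounded multiple of the localized Hilbert kernel by
an integrable convolution kernel is bounded on `L^p`. -/
theorem lintegral_kernel_le {N : ℝ → ℝ → ℝ} {b : ℝ → ℝ} {B K s t p : ℝ} (hp : 2 ≤ p)
    (hs : -1 < s) (ht : t < -1) (hK : 0 ≤ K) (hb : ∀ x, |b x| ≤ B)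
    (hN : ∀ x y, y ≠ 0 → |N x y - b x * hilbertKernel y| ≤ K * powKernel s t y) :
    ∃ C : ℝ≥0∞, C ≠ ⊤ ∧ ∀ g, IsTestFunction g →
      (∀ x, Integrable fun y => N x y * g (x - y) + N x (-y) * g (x + y)) →
      ∫⁻ x, ENNReal.ofReal (|∫ y, (N x y * g (x - y) + N x (-y) * g (x + y))| ^ p) ≤
        C * ∫⁻ x, ENNReal.ofReal (|g x| ^ p) := by
  obtain ⟨A, hA, hH⟩ := lintegral_localHilbert hp
  have hp0 : 0 ≤ p := by linarith
  set κ : ℝ → ℝ≥0∞ := fun y => ENNReal.ofReal (K * powKernel s t y)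
  have hκm : Measurable κ := ((measurable_powKernel s t).const_mul K).ennreal_ofReal
  have hκi : ∫⁻ y, κ y ≠ ⊤ :=
    ((integrable_powKernel hs ht).const_mul K).lintegral_lt_top.ne
  refine ⟨3 ^ p * (ENNReal.ofReal B ^ p * A + (∫⁻ y, κ y) ^ p + (∫⁻ y, κ y) ^ p),
    by finiteness, fun g hg hi => ?_⟩
  have hgm := hg.continuous.measurable
  set G : ℝ → ℝ≥0∞ := fun x => ENNReal.ofReal |g x|
  have hGm : Measurable G := by fun_prop
  -- The localized Hilbert transform is subtracted inside the symmetrized integral, where it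
  -- converges absolutely; the remainder is dominated by two copies of a convolution with an
  -- integrable kernel.
  have hpt : ∀ x, ENNReal.ofReal |∫ y, (N x y * g (x - y) + N x (-y) * g (x + y))| ≤
      ENNReal.ofReal B * ENNReal.ofReal |localHilbert g x| + (∫⁻ y, κ y * G (x - y)) +
        ∫⁻ y, κ y * G (x - y) := by
    intro x
    have hi1 := (integrable_localHilbert hg x).const_mul (b x)
    have e : ∫ y, (N x y * g (x - y) + N x (-y) * g (x + y)) = b x * localHilbert g x +
        ∫ y, ((N x y * g (x - y) + N x (-y) * g (x + y)) -
          b x * (hilbertKernel y * (g (x - y) - g (x + y)))) := by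
      rw [integral_sub (hi x) hi1, integral_const_mul, localHilbert]; ring
    have h1 : ENNReal.ofReal |∫ y, ((N x y * g (x - y) + N x (-y) * g (x + y)) -
        b x * (hilbertKernel y * (g (x - y) - g (x + y))))| ≤
        (∫⁻ y, κ y * G (x - y)) + ∫⁻ y, κ y * G (x - y) := by
      have e2 : ∫⁻ y, κ y * G (x - y) = ∫⁻ y, κ y * G (x + y) := by
        rw [← lintegral_neg_eq_self]
        simp only [κ, powKernel_neg, sub_neg_eq_add]
      nth_rewrite 2 [e2]
      rw [← lintegral_add_left (by fun_prop), ← Real.enorm_eq_ofReal_abs]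
      refine (enorm_integral_le_lintegral_enorm _).trans (lintegral_mono_ae ?_)
      filter_upwards [compl_mem_ae_iff.2 (measure_singleton (0 : ℝ))] with y hy
      have hy : y ≠ 0 := hy
      have hn1 := hN x y hy
      have hn2 := hN x (-y) (neg_ne_zero.2 hy)
      rw [powKernel_neg] at hn2
      have hk := powKernel_nonneg s t y
      simp only [κ, G]
      rw [Real.enorm_eq_ofReal_abs, ← ENNReal.ofReal_mul (by positivity),
        ← ENNReal.ofReal_mul (by positivity), ← ENNReal.ofReal_add (by positivity) (by positivity)]
      refine ENNReal.ofReal_le_ofReal ?_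
      have e3 : (N x y * g (x - y) + N x (-y) * g (x + y)) -
          b x * (hilbertKernel y * (g (x - y) - g (x + y))) =
          (N x y - b x * hilbertKernel y) * g (x - y) +
          (N x (-y) - b x * hilbertKernel (-y)) * g (x + y) := by
        rw [hilbertKernel_neg]; ring
      rw [e3]
      refine (abs_add_le _ _).trans ?_
      rw [abs_mul, abs_mul]
      gcongr
    rw [e, add_assoc]
    refine (ENNReal.ofReal_le_ofReal (abs_add_le _ _)).trans ?_
    rw [ENNReal.ofReal_add (by positivity) (by positivity)]
    refine add_le_add ?_ h1
    rw [abs_mul, ENNReal.ofReal_mul (by positivity)]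
    gcongr
    exact hb x
  have hconv := lintegral_convolution_rpow_le hκm hGm (p := p) (by linarith)
  have e4 : ∫⁻ x, G x ^ p = ∫⁻ x, ENNReal.ofReal (|g x| ^ p) := by
    simp_rw [G, ENNReal.ofReal_rpow_of_nonneg (abs_nonneg _) hp0]
  rw [e4] at hconv
  have hm1 : Measurable fun x => ∫⁻ y, κ y * G (x - y) :=
    Measurable.lintegral_prod_right' (by fun_prop : Measurable fun z : ℝ × ℝ => κ z.2 * G (z.1 - z.2))
  calc _ ≤ ∫⁻ x, 3 ^ p * ((ENNReal.ofReal B * ENNReal.ofReal |localHilbert g x|) ^ p +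
        (∫⁻ y, κ y * G (x - y)) ^ p + (∫⁻ y, κ y * G (x - y)) ^ p) := by
        refine lintegral_mono fun x => ?_
        rw [← ENNReal.ofReal_rpow_of_nonneg (abs_nonneg _) hp0]
        exact (ENNReal.rpow_le_rpow (hpt x) hp0).trans (add_three_rpow_le _ _ _ hp0)
    _ = 3 ^ p * (ENNReal.ofReal B ^ p * (∫⁻ x, ENNReal.ofReal (|localHilbert g x| ^ p)) +
        (∫⁻ x, (∫⁻ y, κ y * G (x - y)) ^ p) + (∫⁻ x, (∫⁻ y, κ y * G (x - y)) ^ p)) := by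
        rw [lintegral_const_mul' _ _ (by finiteness), lintegral_add_right _ (by fun_prop),
          lintegral_add_right _ (by fun_prop)]
        simp_rw [ENNReal.mul_rpow_of_nonneg _ _ hp0]
        rw [lintegral_const_mul' _ _ (by finiteness)]
        simp_rw [ENNReal.ofReal_rpow_of_nonneg (abs_nonneg _) hp0]
    _ ≤ 3 ^ p * (ENNReal.ofReal B ^ p * (A * ∫⁻ x, ENNReal.ofReal (|g x| ^ p)) +
        (∫⁻ y, κ y) ^ p * (∫⁻ x, ENNReal.ofReal (|g x| ^ p)) +
        (∫⁻ y, κ y) ^ p * ∫⁻ x, ENNReal.ofReal (|g x| ^ p)) := by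
        gcongr
        exact hH g hg
    _ = _ := by ring

/-! ### Conjugation of the commutator by the weight. -/

theorem contDiff_weight (s : ℝ) : ContDiff ℝ ∞ (weight s) := by
  unfold weight
  refine ContDiff.rpow_const_of_ne (by fun_prop) fun x => by positivity

theorem IsTestFunction.weight_mul {f : ℝ → ℝ} (hf : IsTestFunction f) (s : ℝ) :
    IsTestFunction fun x => weight s x * f x :=
  ⟨(contDiff_weight s).mul hf.1, hf.2.mul_left⟩

theorem weight_div_weight (s x y : ℝ) :
    weight s x / weight s (x - y) = bracketRatio x y ^ (s / 2) := by
  unfold weight bracketRatio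
  rw [Real.div_rpow (by positivity) (by positivity), neg_div, Real.rpow_neg (by positivity),
    Real.rpow_neg (by positivity), inv_div_inv]

/-- In the commutator the contributions of `f x` cancel, leaving `(m(x) - m(x-y)) f(x-y)` and its
reflection. Multiplying by `weight σ x / weight γ x` and extracting `weight σ (x-y)` turns the
coefficient into `r^(σ/2) - r^((σ-γ)/2)`. -/
theorem weight_mul_commutatorAt {f : ℝ → ℝ} (hf : IsTestFunction f) {α : ℝ} (h0 : 0 < α)
    (h2 : α < 2) (σ γ x : ℝ) :
    (Integrable fun y =>
      commutatorKernel α (σ / 2) ((σ - γ) / 2) x y * (weight σ (x - y) * f (x - y)) +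
      commutatorKernel α (σ / 2) ((σ - γ) / 2) x (-y) * (weight σ (x + y) * f (x + y))) ∧
    weight σ x * commutatorAt α (weight γ) f x = fracConst α / 2 * ∫ y,
      (commutatorKernel α (σ / 2) ((σ - γ) / 2) x y * (weight σ (x - y) * f (x - y)) +
      commutatorKernel α (σ / 2) ((σ - γ) / 2) x (-y) * (weight σ (x + y) * f (x + y))) := by
  have hmf := hf.weight_mul γ
  have hc : ∀ y, commutatorKernel α (σ / 2) ((σ - γ) / 2) x y * weight σ (x - y) =
      weight σ x / weight γ x * (weight γ x - weight γ (x - y)) / |y| ^ (1 + α) := by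
    intro y
    have h1 := (weight_pos σ (x - y)).ne'
    have h3 := (weight_pos γ (x - y)).ne'
    have h4 := (weight_pos γ x).ne'
    rw [commutatorKernel, sub_div σ γ 2, Real.rpow_sub (bracketRatio_pos x y), ← weight_div_weight,
      ← weight_div_weight]
    field_simp
  have e : ∀ y, commutatorKernel α (σ / 2) ((σ - γ) / 2) x y * (weight σ (x - y) * f (x - y)) +
      commutatorKernel α (σ / 2) ((σ - γ) / 2) x (-y) * (weight σ (x + y) * f (x + y)) =
      weight σ x / weight γ x * (symmIntegrand α (fun y => weight γ y * f y) x y -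
        weight γ x * symmIntegrand α f x y) := by
    intro y
    have h1 := hc y
    have h3 := hc (-y)
    rw [sub_neg_eq_add, abs_neg] at h3
    rw [← mul_assoc, ← mul_assoc, h1, h3]
    unfold symmIntegrand
    ring
  have i1 := integrable_symmIntegrand hmf h0 h2 x
  have i2 := (integrable_symmIntegrand hf h0 h2 x).const_mul (weight γ x)
  simp_rw [e]
  refine ⟨(i1.sub i2).const_mul _, ?_⟩
  rw [integral_const_mul, integral_sub i1 i2, integral_const_mul, commutatorAt,
    fracLap_eq_symm hmf h0 h2, fracLap_eq_symm hf h0 h2]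
  ring

theorem lintegral_commutatorAt_le {α σ γ B K s t p : ℝ} {b : ℝ → ℝ} (h0 : 0 < α) (h2 : α < 2)
    (hp : 2 ≤ p) (hs : -1 < s) (ht : t < -1) (hK : 0 ≤ K) (hb : ∀ x, |b x| ≤ B)
    (hN : ∀ x y, y ≠ 0 → |commutatorKernel α (σ / 2) ((σ - γ) / 2) x y - b x * hilbertKernel y| ≤
      K * powKernel s t y) :
    ∃ C : ℝ≥0∞, C ≠ ⊤ ∧ ∀ f, IsTestFunction f →
      ∫⁻ x, ENNReal.ofReal (|weight σ x * commutatorAt α (weight γ) f x| ^ p) ≤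
        C * ∫⁻ x, ENNReal.ofReal (|weight σ x * f x| ^ p) := by
  obtain ⟨C, hC, h⟩ := lintegral_kernel_le hp hs ht hK hb hN
  refine ⟨ENNReal.ofReal (|fracConst α / 2| ^ p) * C, by finiteness, fun f hf => ?_⟩
  have := h _ (hf.weight_mul σ) fun x => (weight_mul_commutatorAt hf h0 h2 σ γ x).1
  have e := fun x => (weight_mul_commutatorAt hf h0 h2 σ γ x).2
  simp_rw [e, abs_mul (fracConst α / 2)]
  simp_rw [Real.mul_rpow (abs_nonneg (fracConst α / 2)) (abs_nonneg _),
    ENNReal.ofReal_mul (Real.rpow_nonneg (abs_nonneg (fracConst α / 2)) p)]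
  rw [lintegral_const_mul' _ _ (by finiteness), mul_assoc]
  gcongr

/-! ### The weighted spaces and their pairings. -/

theorem measurable_weight (s : ℝ) : Measurable (weight s) := (contDiff_weight s).continuous.measurable

theorem weight_le_one {s : ℝ} (hs : 0 ≤ s) (x : ℝ) : weight s x ≤ 1 :=
  Real.rpow_le_one_of_one_le_of_nonpos (by nlinarith [sq_nonneg x]) (by linarith)

theorem weight_mul_weight (s t x : ℝ) : weight s x * weight t x = weight (s + t) x := by
  unfold weight
  rw [← Real.rpow_add (by positivity)]
  congr 1; ring

theorem weight_rpow (s t x : ℝ) : weight s x ^ t = weight (s * t) x := by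
  unfold weight
  rw [← Real.rpow_mul (by positivity)]
  congr 1; ring

theorem integrable_weight {s : ℝ} (hs : 1 < s) : Integrable (weight s) := by
  have := integrable_rpow_neg_one_add_norm_sq (E := ℝ) (μ := volume) (r := s) (by simpa using hs)
  simp only [Real.norm_eq_abs, sq_abs] at this
  exact this

theorem integrable_weightMeasure_iff (β : ℝ) {h : ℝ → ℝ} :
    Integrable h (weightMeasure β) ↔ Integrable fun x => weight β x * h x := by
  unfold weightMeasure
  rw [integrable_withDensity_iff_integrable_smul' (measurable_weight β).ennreal_ofReal
    (ae_of_all _ fun x => ENNReal.ofReal_lt_top)]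
  simp_rw [ENNReal.toReal_ofReal (weight_pos β _).le, smul_eq_mul]

theorem integral_weightMeasure (β : ℝ) (h : ℝ → ℝ) :
    ∫ x, h x ∂(weightMeasure β) = ∫ x, weight β x * h x := by
  unfold weightMeasure
  rw [integral_withDensity_eq_integral_toReal_smul (measurable_weight β).ennreal_ofReal
    (ae_of_all _ fun x => ENNReal.ofReal_lt_top)]
  simp_rw [ENNReal.toReal_ofReal (weight_pos β _).le, smul_eq_mul]

theorem volume_absolutelyContinuous_weightMeasure (β : ℝ) :
    (volume : Measure ℝ) ≪ weightMeasure β :=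
  withDensity_absolutelyContinuous' (measurable_weight β).ennreal_ofReal.aemeasurable
    (ae_of_all _ fun x => (ENNReal.ofReal_pos.2 (weight_pos β x)).ne')

instance isLocallyFiniteMeasure_weightMeasure (β : ℝ) :
    IsLocallyFiniteMeasure (weightMeasure β) :=
  IsLocallyFiniteMeasure.withDensity_ofReal (contDiff_weight β).continuous

theorem eLpNorm_weightMeasure {p : ℝ≥0∞} (hp0 : p ≠ 0) (hp : p ≠ ⊤) (β : ℝ) {h : ℝ → ℝ}
    (hm : Measurable h) : eLpNorm h p (weightMeasure β) =
      (∫⁻ x, ENNReal.ofReal (|weight (β / p.toReal) x * h x| ^ p.toReal)) ^ (1 / p.toReal) := by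
  have hp1 : 0 < p.toReal := ENNReal.toReal_pos hp0 hp
  rw [eLpNorm_eq_lintegral_rpow_enorm_toReal hp0 hp, weightMeasure,
    lintegral_withDensity_eq_lintegral_mul _ (measurable_weight β).ennreal_ofReal (by fun_prop)]
  congr 2 with x
  simp only [Pi.mul_apply]
  rw [abs_mul, abs_of_pos (weight_pos _ _), Real.mul_rpow (weight_pos _ _).le (abs_nonneg _),
    weight_rpow, div_mul_cancel₀ _ hp1.ne', ENNReal.ofReal_mul (weight_pos _ _).le,
    Real.enorm_eq_ofReal_abs, ENNReal.ofReal_rpow_of_nonneg (abs_nonneg _) hp1.le]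

/-- Functions dominated by `(1 + x²)^(-3/4)` act on `L^p(w_β dx)` by integration. -/
theorem exists_pairing {β : ℝ} (hβ0 : 0 < β) (hβ1 : β < 1) (p : ℝ≥0∞) [Fact (1 ≤ p)]
    (hp : 1 < p) {ψ : ℝ → ℝ} (hψ : Measurable ψ) {K : ℝ}
    (hK : ∀ x, |ψ x| ≤ K * weight (3 / 2) x) :
    ∃ ℓ : Lp ℝ p (weightMeasure β) →L[ℝ] ℝ,
      ∀ f, Integrable (fun x => f x * ψ x) ∧ ℓ f = ∫ x, f x * ψ x := by
  have hK0 : 0 ≤ K := by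
    have := (abs_nonneg _).trans (hK 0)
    by_contra h
    exact absurd this (not_le.2 (mul_neg_of_neg_of_pos (not_le.1 h) (weight_pos _ _)))
  set q : ℝ≥0∞ := (1 - p⁻¹)⁻¹
  have hpq : p.HolderConjugate q := ENNReal.HolderConjugate.inv_one_sub_inv' hp.le
  have hq1 : 1 ≤ q := by simp [q]
  have hqt : q ≠ ⊤ := by
    simp only [q, ne_eq, ENNReal.inv_eq_top, tsub_eq_zero_iff_le, not_le]
    exact ENNReal.inv_lt_one.2 hp
  have : Fact (1 ≤ q) := ⟨hq1⟩
  have hq0 : q ≠ 0 := (zero_lt_one.trans_le hq1).ne'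
  have hqr : 1 ≤ q.toReal := by
    rw [← ENNReal.toReal_one]; exact ENNReal.toReal_mono hqt hq1
  -- Pairing with `ψ` for `dx` is pairing with `ψ / w_β` for `w_β dx`. As `w_{3/2-β} ≤ 1`, its
  -- `q`-th power is at most itself, and multiplication by `w_β` gives back the integrable
  -- `w_{3/2}`.
  set G : ℝ → ℝ := fun x => weight (-β) x * ψ x
  have hGm : Measurable G := (measurable_weight _).mul hψ
  have hwG : ∀ x, weight β x * G x = ψ x := by
    intro x
    simp only [G]
    rw [← mul_assoc, weight_mul_weight, add_neg_cancel]
    simp [weight]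
  have hGb : ∀ x, |G x| ≤ K * weight (3 / 2 - β) x := by
    intro x
    simp only [G]
    rw [abs_mul, abs_of_pos (weight_pos _ _)]
    calc _ ≤ weight (-β) x * (K * weight (3 / 2) x) := by
          gcongr
          · exact (weight_pos _ _).le
          · exact hK x
      _ = K * (weight (-β) x * weight (3 / 2) x) := by ring
      _ = _ := by rw [weight_mul_weight]; congr 2; ring
  have hG : MemLp G q (weightMeasure β) := by
    rw [← integrable_norm_rpow_iff hGm.aestronglyMeasurable hq0 hqt, integrable_weightMeasure_iff]
    refine ((integrable_weight (s := 3 / 2) (by norm_num)).const_mul (K ^ q.toReal)).mono'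
      (by have := measurable_weight β; fun_prop : Measurable _).aestronglyMeasurable
      (ae_of_all _ fun x => ?_)
    rw [Real.norm_eq_abs, abs_mul, abs_of_pos (weight_pos _ _), Real.norm_eq_abs,
      abs_of_nonneg (by positivity)]
    have h1 : |G x| ^ q.toReal ≤ K ^ q.toReal * weight (3 / 2 - β) x := by
      calc _ ≤ (K * weight (3 / 2 - β) x) ^ q.toReal := by gcongr; exact hGb x
        _ = K ^ q.toReal * weight (3 / 2 - β) x ^ q.toReal :=
          Real.mul_rpow hK0 (weight_pos _ _).le
        _ ≤ _ := by
          gcongr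
          exact Real.rpow_le_self_of_le_one (weight_pos _ _).le (weight_le_one (by linarith) x) hqr
    calc _ ≤ weight β x * (K ^ q.toReal * weight (3 / 2 - β) x) := by
          gcongr
          exact (weight_pos _ _).le
      _ = K ^ q.toReal * (weight β x * weight (3 / 2 - β) x) := by ring
      _ = _ := by rw [weight_mul_weight, add_sub_cancel]
  refine ⟨((ContinuousLinearMap.mul ℝ ℝ).lpPairing (weightMeasure β) p q).flip (hG.toLp G),
    fun f => ⟨?_, ?_⟩⟩
  · have h1 : Integrable (fun x => f x * G x) (weightMeasure β) :=
      (Lp.memLp f).integrable_mul hG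
    rw [integrable_weightMeasure_iff] at h1
    refine h1.congr (ae_of_all _ fun x => ?_)
    change weight β x * (f x * G x) = f x * ψ x
    rw [← hwG x]; ring
  · rw [ContinuousLinearMap.flip_apply, ContinuousLinearMap.lpPairing_eq_integral]
    have h2 : ∫ x, (ContinuousLinearMap.mul ℝ ℝ) (f x) ((hG.toLp G) x) ∂(weightMeasure β) =
        ∫ x, f x * G x ∂(weightMeasure β) := by
      refine integral_congr_ae ?_
      filter_upwards [hG.coeFn_toLp] with x hx
      rw [hx]; rfl
    rw [h2, integral_weightMeasure]
    congr 1 with x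
    rw [← hwG x]; ring

/-! ### Linearity, duality and extension from test functions. -/

theorem IsTestFunction.add {f g : ℝ → ℝ} (hf : IsTestFunction f) (hg : IsTestFunction g) :
    IsTestFunction (f + g) := ⟨hf.1.add hg.1, hf.2.add hg.2⟩

theorem IsTestFunction.smul {f : ℝ → ℝ} (hf : IsTestFunction f) (c : ℝ) :
    IsTestFunction (c • f) := ⟨hf.1.const_smul c, hf.2.smul_left⟩

theorem fracLap_add {f g : ℝ → ℝ} (hf : IsTestFunction f) (hg : IsTestFunction g) {α : ℝ}
    (h0 : 0 < α) (h2 : α < 2) (x : ℝ) :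
    fracLap α (f + g) x = fracLap α f x + fracLap α g x := by
  rw [fracLap_eq_symm hf h0 h2, fracLap_eq_symm hg h0 h2, fracLap_eq_symm (hf.add hg) h0 h2,
    ← mul_add, ← integral_add (integrable_symmIntegrand hf h0 h2 x)
    (integrable_symmIntegrand hg h0 h2 x)]
  congr 2 with y
  simp only [symmIntegrand, Pi.add_apply]
  ring

theorem fracLap_smul {f : ℝ → ℝ} (hf : IsTestFunction f) {α : ℝ}
    (h0 : 0 < α) (h2 : α < 2) (c x : ℝ) :
    fracLap α (c • f) x = c * fracLap α f x := by
  have e : ∀ y, symmIntegrand α (c • f) x y = c * symmIntegrand α f x y := by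
    intro y
    simp only [symmIntegrand, Pi.smul_apply, smul_eq_mul]
    ring
  rw [fracLap_eq_symm hf h0 h2, fracLap_eq_symm (hf.smul c) h0 h2]
  simp_rw [e]
  rw [integral_const_mul, mul_left_comm]

theorem commutatorAt_add {f g : ℝ → ℝ} (hf : IsTestFunction f) (hg : IsTestFunction g) {α : ℝ}
    (h0 : 0 < α) (h2 : α < 2) (γ : ℝ) :
    commutatorAt α (weight γ) (f + g) =
      commutatorAt α (weight γ) f + commutatorAt α (weight γ) g := by
  ext x
  have e : (fun y => weight γ y * (f y + g y)) =
      (fun y => weight γ y * f y) + fun y => weight γ y * g y := by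
    ext y; simp only [Pi.add_apply, mul_add]
  simp only [commutatorAt, Pi.add_apply]
  rw [e, fracLap_add hf hg h0 h2, fracLap_add (hf.weight_mul γ) (hg.weight_mul γ) h0 h2]
  ring

theorem commutatorAt_smul {f : ℝ → ℝ} (hf : IsTestFunction f) {α : ℝ}
    (h0 : 0 < α) (h2 : α < 2) (γ c : ℝ) :
    commutatorAt α (weight γ) (c • f) = c • commutatorAt α (weight γ) f := by
  ext x
  have e : (fun y => weight γ y * (c * f y)) = c • fun y => weight γ y * f y := by
    ext y; simp only [Pi.smul_apply, smul_eq_mul]; ring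
  simp only [commutatorAt, Pi.smul_apply, smul_eq_mul]
  rw [e, fracLap_smul hf h0 h2, fracLap_smul (hf.weight_mul γ) h0 h2]
  ring

theorem measurable_commutatorAt {f : ℝ → ℝ} (hf : IsTestFunction f) {α : ℝ}
    (h0 : 0 < α) (h2 : α < 2) (γ : ℝ) : Measurable (commutatorAt α (weight γ) f) := by
  have h3 := measurable_fracLap hf h0 h2
  have h4 := measurable_fracLap (hf.weight_mul γ) h0 h2
  have h5 := measurable_weight γ
  unfold commutatorAt
  fun_prop

theorem IsTestFunction.div_weight {φ : ℝ → ℝ} (hφ : IsTestFunction φ) (γ : ℝ) :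
    IsTestFunction fun x => φ x / weight γ x := by
  have e : (fun x => φ x / weight γ x) = fun x => weight (-γ) x * φ x := by
    ext x
    have h : weight γ x * weight (-γ) x = 1 := by
      rw [weight_mul_weight, add_neg_cancel]; simp [weight]
    rw [div_eq_iff (weight_pos γ x).ne', mul_right_comm, mul_comm (weight (-γ) x), h, one_mul]
  rw [e]
  exact hφ.weight_mul (-γ)

/-- For `α ≥ 1/2` the decay `|x|^(-1-α)` is at least that of `weight (3 / 2)`, the form required by
`exists_pairing`. -/
theorem exists_fracLap_le_weight {f : ℝ → ℝ} (hf : IsTestFunction f) {α : ℝ} (h0 : 1 / 2 ≤ α)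
    (h2 : α < 2) : ∃ K, 0 ≤ K ∧ ∀ x, |fracLap α f x| ≤ K * weight (3 / 2) x := by
  obtain ⟨K, hK, h⟩ := exists_fracLap_le hf (by linarith) h2
  refine ⟨K, hK, fun x => (h x).trans ?_⟩
  unfold weight
  gcongr ?_ * ?_
  exact Real.rpow_le_rpow_of_exponent_le (by nlinarith [sq_nonneg x]) (by linarith)

theorem integrable_fracLap_mul {f g : ℝ → ℝ} (hf : IsTestFunction f) (hg : IsTestFunction g)
    {α : ℝ} (h0 : 1 / 2 ≤ α) (h2 : α < 2) : Integrable fun x => fracLap α f x * g x := by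
  obtain ⟨K, hK, h⟩ := exists_fracLap_le_weight hf h0 h2
  refine hg.integrable.bdd_mul (c := K)
    (measurable_fracLap hf (by linarith) h2).aestronglyMeasurable (ae_of_all _ fun x => ?_)
  exact (h x).trans (mul_le_of_le_one_right hK (weight_le_one (by norm_num) x))

theorem integral_commutatorAt_mul {f φ : ℝ → ℝ} (hf : IsTestFunction f) (hφ : IsTestFunction φ)
    {α : ℝ} (h0 : 1 / 2 ≤ α) (h2 : α < 2) (γ : ℝ) :
    ∫ x, commutatorAt α (weight γ) f x * φ x =
      (∫ x, weight γ x * f x * fracLap α (fun y => φ y / weight γ y) x) -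
        ∫ x, f x * fracLap α φ x := by
  have h0' : 0 < α := by linarith
  rw [← integral_fracLap_mul (hf.weight_mul γ) (hφ.div_weight γ) h0' h2,
    ← integral_fracLap_mul hf hφ h0' h2, ← integral_sub
    (integrable_fracLap_mul (hf.weight_mul γ) (hφ.div_weight γ) h0 h2)
    (integrable_fracLap_mul hf hφ h0 h2)]
  congr 1 with x
  have := (weight_pos γ x).ne'
  rw [commutatorAt]
  field_simp

theorem IsTestFunction.exists_le_weight {φ : ℝ → ℝ} (hφ : IsTestFunction φ) (s : ℝ) :
    ∃ K, ∀ x, |φ x| ≤ K * weight s x := by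
  obtain ⟨K, -, h⟩ := (hφ.div_weight s).exists_abs_le
  refine ⟨K, fun x => ?_⟩
  have := h x
  rwa [abs_div, abs_of_pos (weight_pos s x), div_le_iff₀ (weight_pos s x)] at this

/-- The test functions form a subspace. -/
def testSubmodule : Submodule ℝ (ℝ → ℝ) where
  carrier := {f | IsTestFunction f}
  add_mem' hf hg := IsTestFunction.add hf hg
  zero_mem' := ⟨contDiff_const, HasCompactSupport.zero⟩
  smul_mem' c _ hf := IsTestFunction.smul hf c

theorem IsTestFunction.memLp {f : ℝ → ℝ} (hf : IsTestFunction f) (p : ℝ≥0∞) (β : ℝ) :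
    MemLp f p (weightMeasure β) :=
  hf.continuous.memLp_of_hasCompactSupport hf.2

/-- The inclusion of the test functions into `L^p(w_β dx)`. -/
noncomputable def testToLp (p : ℝ≥0∞) (β : ℝ) :
    testSubmodule →ₗ[ℝ] Lp ℝ p (weightMeasure β) where
  toFun f := MemLp.toLp f.1 (IsTestFunction.memLp f.2 p β)
  map_add' _ _ := rfl
  map_smul' _ _ := rfl

theorem denseRange_testToLp (p : ℝ≥0∞) [Fact (1 ≤ p)] (hp : p ≠ ⊤) (β : ℝ) :
    DenseRange (testToLp p β) := by
  refine (Lp.dense_hasCompactSupport_contDiff (μ := weightMeasure β) (F := ℝ) hp).mono ?_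
  rintro f ⟨g, hfg, hg1, hg2⟩
  refine ⟨⟨g, hg2, hg1⟩, ?_⟩
  refine Lp.ext ?_
  exact (MemLp.coeFn_toLp (IsTestFunction.memLp ⟨hg2, hg1⟩ p β)).trans hfg.symm

/-- A bound on test functions yields the bounded extension of the commutator to `L^p(w_β dx)`. -/
theorem commutatorBounded_of_lintegral_le {β γ α : ℝ} (hβ0 : 0 < β) (hβ1 : β < 1) (hγ : 0 ≤ γ)
    (h0 : 1 / 2 ≤ α) (h2 : α < 2) (p : ℝ≥0∞) [Fact (1 ≤ p)] (hp : 1 < p) (hp_top : p ≠ ⊤)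
    (hbound : ∃ C : ℝ≥0∞, C ≠ ⊤ ∧ ∀ f, IsTestFunction f →
      ∫⁻ x, ENNReal.ofReal
        (|weight (β / p.toReal) x * commutatorAt α (weight γ) f x| ^ p.toReal) ≤
        C * ∫⁻ x, ENNReal.ofReal (|weight (β / p.toReal) x * f x| ^ p.toReal)) :
    CommutatorBounded α (weight γ) p (weightMeasure β) := by
  obtain ⟨C, hC, hCb⟩ := hbound
  have h0' : 0 < α := by linarith
  have hp0 : p ≠ 0 := (zero_lt_one.trans hp).ne'
  have hpr : 0 ≤ 1 / p.toReal := by positivity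
  set D : ℝ≥0∞ := C ^ (1 / p.toReal)
  have hD : D ≠ ⊤ := ENNReal.rpow_ne_top_of_nonneg hpr hC
  have hnorm : ∀ f, IsTestFunction f → eLpNorm (commutatorAt α (weight γ) f) p (weightMeasure β) ≤
      D * eLpNorm f p (weightMeasure β) := by
    intro f hf
    rw [eLpNorm_weightMeasure hp0 hp_top β (measurable_commutatorAt hf h0' h2 γ),
      eLpNorm_weightMeasure hp0 hp_top β hf.continuous.measurable,
      ← ENNReal.mul_rpow_of_nonneg _ _ hpr]
    exact ENNReal.rpow_le_rpow (hCb f hf) hpr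
  have hmem : ∀ f, IsTestFunction f →
      MemLp (commutatorAt α (weight γ) f) p (weightMeasure β) := fun f hf =>
    ⟨(measurable_commutatorAt hf h0' h2 γ).aestronglyMeasurable,
      (hnorm f hf).trans_lt (ENNReal.mul_lt_top hD.lt_top (hf.memLp p β).2)⟩
  let S : testSubmodule →ₗ[ℝ] Lp ℝ p (weightMeasure β) :=
    { toFun := fun f => (hmem f.1 f.2).toLp _
      map_add' := fun f g => by
        rw [← MemLp.toLp_add]
        exact MemLp.toLp_congr _ _ (by
          rw [← commutatorAt_add f.2 g.2 h0' h2]; rfl)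
      map_smul' := fun c f => by
        rw [RingHom.id_apply, ← MemLp.toLp_const_smul]
        exact MemLp.toLp_congr _ _ (by
          rw [← commutatorAt_smul f.2 h0' h2]; rfl) }
  have hS : ∃ M, ∀ f, ‖S f‖ ≤ M * ‖testToLp p β f‖ := by
    refine ⟨D.toReal, fun f => ?_⟩
    have e1 : ‖S f‖ = (eLpNorm (commutatorAt α (weight γ) f.1) p (weightMeasure β)).toReal :=
      Lp.norm_toLp _ (hmem f.1 f.2)
    have e2 : ‖testToLp p β f‖ = (eLpNorm f.1 p (weightMeasure β)).toReal :=
      Lp.norm_toLp _ (IsTestFunction.memLp f.2 p β)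
    rw [e1, e2, ← ENNReal.toReal_mul]
    exact ENNReal.toReal_mono
      (ENNReal.mul_ne_top hD (IsTestFunction.memLp f.2 p β).2.ne) (hnorm f.1 f.2)
  have hdense := denseRange_testToLp p hp_top β
  set T := S.extendOfNorm (testToLp p β)
  have hT : ∀ f : testSubmodule, T (testToLp p β f) = S f :=
    LinearMap.extendOfNorm_eq hdense hS
  refine ⟨T, fun f hf => ⟨fun x => ⟨fracLapExists hf h0' h2 x,
    fracLapExists (hf.weight_mul γ) h0' h2 x⟩, hf.memLp p β, ?_⟩, fun f φ hφ => ?_⟩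
  · have := hT ⟨f, hf⟩
    change T ((hf.memLp p β).toLp f) = _ at this
    rw [this]
    exact MemLp.coeFn_toLp (hmem f hf)
  · obtain ⟨K₁, hK₁⟩ := hφ.exists_le_weight (3 / 2)
    obtain ⟨K₂, hK₂0, hK₂⟩ := exists_fracLap_le_weight (hφ.div_weight γ) h0 h2
    obtain ⟨K₃, -, hK₃⟩ := exists_fracLap_le_weight hφ h0 h2
    obtain ⟨ℓ₁, h₁⟩ := exists_pairing hβ0 hβ1 p hp hφ.continuous.measurable hK₁
    have hm := measurable_fracLap (hφ.div_weight γ) h0' h2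
    obtain ⟨ℓ₂, h₂⟩ := exists_pairing hβ0 hβ1 p hp
      (ψ := fun x => weight γ x * fracLap α (fun y => φ y / weight γ y) x)
      ((measurable_weight γ).mul hm) (K := K₂) fun x => by
        rw [abs_mul, abs_of_pos (weight_pos γ x)]
        exact (mul_le_of_le_one_left (abs_nonneg _) (weight_le_one hγ x)).trans (hK₂ x)
    obtain ⟨ℓ₃, h₃⟩ := exists_pairing hβ0 hβ1 p hp (measurable_fracLap hφ h0' h2) hK₃
    have e₂ : ∀ (u : ℝ → ℝ) x, weight γ x * u x * fracLap α (fun y => φ y / weight γ y) x =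
        u x * (weight γ x * fracLap α (fun y => φ y / weight γ y) x) := fun u x => by ring
    have hac := volume_absolutelyContinuous_weightMeasure β
    -- Both sides are continuous in `f`, so the distributional identity need only be checked on test
    -- functions, where it is the symmetry of `Λ^α`.
    have key : (fun f => ℓ₁ (T f)) = fun f => ℓ₂ f - ℓ₃ f := by
      refine hdense.equalizer (by fun_prop) (by fun_prop) (funext fun u => ?_)
      have a1 : ∀ᵐ x, (S u) x = commutatorAt α (weight γ) u.1 x :=
        hac.ae_le (MemLp.coeFn_toLp (hmem u.1 u.2))
      have a2 : ∀ᵐ x, (testToLp p β u) x = u.1 x :=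
        hac.ae_le (MemLp.coeFn_toLp (IsTestFunction.memLp u.2 p β))
      simp only [Function.comp_apply]
      rw [hT, (h₁ _).2, (h₂ _).2, (h₃ _).2]
      have c1 : ∫ x, (S u) x * φ x = ∫ x, commutatorAt α (weight γ) u.1 x * φ x :=
        integral_congr_ae (a1.mono fun x hx => by simp only [hx])
      have c2 : ∫ x, (testToLp p β u) x *
          (weight γ x * fracLap α (fun y => φ y / weight γ y) x) =
          ∫ x, weight γ x * u.1 x * fracLap α (fun y => φ y / weight γ y) x :=
        integral_congr_ae (a2.mono fun x hx => by simp only [hx, e₂])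
      have c3 : ∫ x, (testToLp p β u) x * fracLap α φ x = ∫ x, u.1 x * fracLap α φ x :=
        integral_congr_ae (a2.mono fun x hx => by simp only [hx])
      rw [c1, c2, c3]
      exact integral_commutatorAt_mul u.2 hφ h0 h2 γ
    have k : ℓ₁ (T f) = ℓ₂ f - ℓ₃ f := congrFun key f
    rw [(h₁ _).2, (h₂ _).2, (h₃ _).2] at k
    simp_rw [e₂]
    exact ⟨(h₁ _).1, (h₂ _).1, (h₃ _).1, k⟩

/-! ### The two cases of the theorem. -/

theorem sqrt_weight (β x : ℝ) : √(weight β x) = weight (β / 2) x := by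
  rw [Real.sqrt_eq_rpow, weight_rpow, mul_one_div]

theorem mainTheorem3 (β : ℝ) (hβ0 : 0 < β) (hβ1 : β < 1)
    (p : ℝ≥0∞) [Fact (1 ≤ p)] (hp : 2 ≤ p) (hp_top : p ≠ ⊤) :
    (3 / 2 - β * (1 - 1 / p.toReal) > 1 →
      CommutatorBounded (1 / 2) (weight β) p (weightMeasure β)) ∧
    CommutatorBounded 1 (fun x => √(weight β x)) p (weightMeasure β) := by
  have hp1 : 1 < p := ENNReal.one_lt_two.trans_le hp
  have hpr : 2 ≤ p.toReal := by
    simpa using ENNReal.toReal_mono hp_top hp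
  set r := p.toReal
  have hr0 : 0 < r := by linarith
  have hσ : β / r < 1 / 2 := by
    rw [div_lt_iff₀ hr0]; linarith
  have hσ0 : 0 < β / r := by positivity
  have hσβ : β / r ≤ β := div_le_self hβ0.le (by linarith)
  have hβr : β * (1 - 1 / r) = β - β / r := by ring
  constructor
  · intro h
    rw [hβr] at h
    set μ := max (β / r / 2) ((β - β / r) / 2)
    -- The first entry is small because `β/p < 1/2`, the second because the hypothesis says `β - β/p
    -- < 1/2`. With `μ < 1/4` the tail exponent `2μ - 3/2` is below `-1`.
    have hμ : μ < 1 / 4 := max_lt (by linarith) (by linarith)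
    have ha : |β / r / 2| ≤ μ := by
      rw [abs_of_pos (by positivity)]; exact le_max_left _ _
    have hc : |(β / r - β) / 2| ≤ μ := by
      rw [abs_of_nonpos (by linarith)]
      exact le_max_of_le_right (by linarith)
    obtain ⟨K, hK, hN⟩ := exists_commutatorKernel_le (α := 1 / 2) ha hc
    -- No singular part is needed (`b = 0`): the kernel is already dominated by an integrable one.
    refine commutatorBounded_of_lintegral_le hβ0 hβ1 hβ0.le le_rfl (by norm_num) p hp1 hp_top
      (lintegral_commutatorAt_le (b := 0) (B := 0) (by norm_num) (by norm_num) hpr (s := -(1 / 2))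
      (t := 2 * μ - (1 + 1 / 2)) (by norm_num) (by linarith) hK (by simp) fun x y hy => ?_)
    simpa using hN x y hy
  · have e : (fun x => √(weight β x)) = weight (β / 2) := funext (sqrt_weight β)
    rw [e]
    -- For `α = 1` the bound `μ = 1/4` gives the tail exponent `-3/2`, so no restriction beyond `β <
    -- 1` and `p ≥ 2` arises.
    have ha : |β / r / 2| ≤ 1 / 4 := by
      rw [abs_of_pos (by positivity)]; linarith
    have hc : |(β / r - β / 2) / 2| ≤ 1 / 4 := by
      rw [abs_le]; constructor <;> linarith
    obtain ⟨K, hK, hN⟩ := exists_commutatorKernel_sub_hilbertKernel_le ha hc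
    refine commutatorBounded_of_lintegral_le hβ0 hβ1 (by positivity) (by norm_num) (by norm_num) p
      hp1 hp_top (lintegral_commutatorAt_le
      (b := fun x => -2 * (β / r / 2 - (β / r - β / 2) / 2) * (x / (1 + x ^ 2)))
      (B := |-2 * (β / r / 2 - (β / r - β / 2) / 2)|) (by norm_num) (by norm_num) hpr (s := 0)
      (t := 2 * (1 / 4) - 2) (by norm_num) (by norm_num) hK (fun x => ?_) hN)
    rw [abs_mul]
    exact mul_le_of_le_one_right (abs_nonneg _) (abs_div_one_add_sq_le x)
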